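/- Consider a two-qubit system with Hilbert space $\mathcal H=\mathbb C^2\otimes\mathbb C^2$ and a unitary operator $U$ on $\mathcal H$. The Schmidt coefficients $s_0\ge s_1\ge s_2\ge s_3\ge 0$ of $U$ are the Schmidt coefficients of its Choi state $U\,|\Phi\rangle_{AA'}\otimes|\Phi\rangle_{BB'}$, where $|\Phi\rangle=\frac1{\sqrt2}(|00\rangle+|11\rangle)$ and $U$ acts on $AB$, with respect to the partition between $AA'$ and $BB'$. A verification protocol for $U$ consists of a finite set $\{|\psi_j\rangle\}_j$ of distinct pure product test states, chosen with probabilities $p_j>0$, $\sum_jp_j=1$, and, for each $j$, finitely many tests of the output state $U|\psi_j\rangle$, performed with probabilities $p_{l|j}>0$, $\sum_lp_{l|j}=1$. In each test the two parties perform nonadaptive local projective measurements $\{P_a\}$, $\{Q_b\}$ and accept the outcome pair $(a,b)$ with some probability $f(a,b)\in[0,1]$; the test operator is $E_{l|j}=\sum_{a,b}f(a,b)\,P_a\otimes Q_b$, and it must satisfy $E_{l|j}U|\psi_j\rangle=U|\psi_j\rangle$. Put $\Omega_j=\sum_l p_{l|j}E_{l|j}$. The protocol is ordinary if for each $j$ the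 spectral gap $1-\beta(\Omega_j)$ is positive, where $\beta(\Omega_j)$ is the second largest eigenvalue of $\Omega_j$, counted with multiplicity. It verifies $U$ reliably if every completely positive trace-preserving linear map $\Lambda$ with $\operatorname{tr}[\Omega_j\Lambda(|\psi_j\rangle\langle\psi_j|)]=1$ for all $j$ satisfies $\Lambda(\rho)=U\rho U^\dagger$ for all density operators $\rho$. It is entanglement free if all the output states $U|\psi_j\rangle$ (like all the test states $|\psi_j\rangle$) are product states. One experimental setting is the preparation of one test state together with one local projective measurement on the output state, so the number of settings of the protocol is its number of pairs $(j,l)$. Let $\mu(U)$ be the minimum number of settings of an ordinary protocol that verifies $U$ reliably. Theorem. Let $U$ be a two-qubit unitary operator with Schmidt coefficients $s_0\ge s_1\ge s_2\ge s_3$. Then $$\mu(U)=\begin{cases}5 & \text{if } s_0>s_1=s_2=s_3>0,\\ 4&\text{otherwise.}\end{cases}$$ Moreover, $U$ can be verified reliably by an entanglement-free protocol if and only if the condition $s_0>s_1=s_2=s_3>0$ fails; the same equivalence holds if only ordinary entanglement-free protocols are allowed. -/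

import Mathlib

open scoped Matrix Kronecker ComplexOrder

noncomputable section

namespace TwoQubit

/-- Index set of the computational basis of a two-qubit system `A ⊗ B`. -/
abbrev Idx : Type := Fin 2 × Fin 2

/-- Operators on the two-qubit Hilbert space, as matrices in the computational basis. -/
abbrev Op : Type := Matrix Idx Idx ℂ

/-! ### States -/

/-- A ket is (the vector of) a pure state if it is normalized. -/
def IsState {n : Type*} [Fintype n] (ψ : n → ℂ) : Prop := star ψ ⬝ᵥ ψ = 1

/-- The product vector `|a⟩ ⊗ |b⟩`. -/
def tensor (a b : Fin 2 → ℂ) : Idx → ℂ := fun p => a p.1 * b p.2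

/-- Pure product states. -/
def IsProduct (ψ : Idx → ℂ) : Prop :=
  ∃ a b : Fin 2 → ℂ, IsState a ∧ IsState b ∧ ψ = tensor a b

/-- The rank-one operator `|ψ⟩⟨ψ|`. -/
def ketbra (ψ : Idx → ℂ) : Op := Matrix.vecMulVec ψ (star ψ)

/-- Density operators. -/
def IsDensity (ρ : Op) : Prop := ρ.PosSemidef ∧ ρ.trace = 1

/-! ### Quantum processes -/

/-- The map `id_k ⊗ Λ` on `k × k` block matrices. -/
def ampliation (k : ℕ) (Λ : Op →ₗ[ℂ] Op) (X : Matrix (Fin k × Idx) (Fin k × Idx) ℂ) :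
    Matrix (Fin k × Idx) (Fin k × Idx) ℂ :=
  Matrix.of fun p q => Λ (Matrix.of fun a b => X (p.1, a) (q.1, b)) p.2 q.2

/-- Quantum processes: completely positive trace-preserving linear maps. -/
structure IsChannel (Λ : Op →ₗ[ℂ] Op) : Prop where
  completelyPositive : ∀ (k : ℕ) (X : Matrix (Fin k × Idx) (Fin k × Idx) ℂ),
    X.PosSemidef → (ampliation k Λ X).PosSemidef
  tracePreserving : ∀ X : Op, (Λ X).trace = X.trace

/-! ### Local projective measurements and tests -/

/-- A projective measurement on one qubit. -/
structure ProjMeas where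
  outcomes : ℕ
  proj : Fin outcomes → Matrix (Fin 2) (Fin 2) ℂ
  hermitian : ∀ a, (proj a).IsHermitian
  orthogonal : ∀ a b, proj a * proj b = if a = b then proj a else 0
  complete : ∑ a, proj a = 1

/-- A test that is realized by one measurement setting: each of the two parties performs a
projective measurement on its qubit, the choice of which does not depend on the outcome of the
other party, and the pair of outcomes `(a, b)` is accepted with probability `accept a b`
(`0` or `1` when the data processing is deterministic). -/
structure LocalTest where
  measA : ProjMeas
  measB : ProjMeas
  accept : Fin measA.outcomes → Fin measB.outcomes → ℝ
  accept_nonneg : ∀ a b, 0 ≤ accept a b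
  accept_le_one : ∀ a b, accept a b ≤ 1

/-- The test operator `E` of a test; the test is passed with probability `tr (E ρ)`. -/
def LocalTest.op (T : LocalTest) : Op :=
  ∑ a, ∑ b, (T.accept a b : ℂ) • (T.measA.proj a ⊗ₖ T.measB.proj b)

theorem LocalTest.op_isHermitian (T : LocalTest) : T.op.IsHermitian := by
  unfold Matrix.IsHermitian LocalTest.op
  simp only [Matrix.conjTranspose_sum, Matrix.conjTranspose_smul, Matrix.conjTranspose_kronecker,
    (T.measA.hermitian _).eq, (T.measB.hermitian _).eq, Complex.star_def, Complex.conj_ofReal]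

/-! ### Verification of states -/

/-- A verification protocol for the pure state `Ψ`: the test `test l` is performed with
probability `prob l`, and `Ψ` passes every test with certainty. Each test is one measurement
setting. -/
structure StateProtocol (Ψ : Idx → ℂ) where
  size : ℕ
  test : Fin size → LocalTest
  prob : Fin size → ℝ
  prob_pos : ∀ l, 0 < prob l
  prob_sum : ∑ l, prob l = 1
  passes : ∀ l, (test l).op *ᵥ Ψ = Ψ

namespace StateProtocol

variable {Ψ : Idx → ℂ}

/-- The verification operator `Ω = ∑ p_l E_l`. -/
def verifOp (S : StateProtocol Ψ) : Op := ∑ l, (S.prob l : ℂ) • (S.test l).op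

theorem verifOp_isHermitian (S : StateProtocol Ψ) : S.verifOp.IsHermitian := by
  unfold Matrix.IsHermitian verifOp
  simp only [Matrix.conjTranspose_sum, Matrix.conjTranspose_smul,
    (LocalTest.op_isHermitian _).eq, Complex.star_def, Complex.conj_ofReal]

/-- The second largest eigenvalue `β(Ω)`, counted with multiplicity (`eigenvalues₀` lists the four
eigenvalues in nonincreasing order, starting from the index `0`). -/
def secondEigenvalue (S : StateProtocol Ψ) : ℝ :=
  S.verifOp_isHermitian.eigenvalues₀ ⟨1, by simp [Idx]⟩

/-- The spectral gap `ν(Ω) = 1 - β(Ω)`. -/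
def spectralGap (S : StateProtocol Ψ) : ℝ := 1 - S.secondEigenvalue

end StateProtocol

/-! ### Verification of unitaries -/

/-- A verification protocol for `U`: a finite set of test states, which are pure product states,
chosen with positive probabilities, together with a verification protocol for the output
state associated with each test state. -/
structure GateProtocol (U : Op) where
  size : ℕ
  input : Fin size → Idx → ℂ
  input_product : ∀ j, IsProduct (input j)
  input_distinct : Function.Injective fun j => ketbra (input j)
  prob : Fin size → ℝ
  prob_pos : ∀ j, 0 < prob j
  prob_sum : ∑ j, prob j = 1
  output : ∀ j, StateProtocol (U *ᵥ input j)

namespace GateProtocol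

variable {U : Op}

/-- The number of experimental settings: one setting is the preparation of a test state
and a local projective measurement on the output state. -/
def settings (P : GateProtocol U) : ℕ := ∑ j, (P.output j).size

/-- A protocol is ordinary if every test state is effective. -/
def Ordinary (P : GateProtocol U) : Prop := ∀ j, 0 < (P.output j).spectralGap

/-- The process `Λ` passes each test with certainty. -/
def PassesWithCertainty (P : GateProtocol U) (Λ : Op →ₗ[ℂ] Op) : Prop :=
  ∀ j, ((P.output j).verifOp * Λ (ketbra (P.input j))).trace = 1

/-- A protocol verifies `U` reliably if `ρ ↦ U ρ U†` is the only quantum process that passes each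
test with certainty. -/
def Reliable (P : GateProtocol U) : Prop :=
  ∀ Λ : Op →ₗ[ℂ] Op, IsChannel Λ → P.PassesWithCertainty Λ →
    ∀ ρ : Op, IsDensity ρ → Λ ρ = U * ρ * Uᴴ

/-- A protocol is entanglement free if all test states and all corresponding output states are
product states (all measurements are local projective measurements by construction). -/
def EntanglementFree (P : GateProtocol U) : Prop :=
  ∀ j, IsProduct (P.input j) ∧ IsProduct (U *ᵥ P.input j)

end GateProtocol

/-- `μ(U)`: the minimum number of experimental settings of an ordinary protocol that verifies `U`
reliably. -/
def mu (U : Op) : ℕ :=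
  sInf {n : ℕ | ∃ P : GateProtocol U, P.Ordinary ∧ P.Reliable ∧ P.settings = n}

/-! ### Schmidt coefficients -/

/-- The maximally entangled two-qubit state `(|00⟩ + |11⟩) / √2`. -/
def bell (k l : Fin 2) : ℂ := if k = l then ((Real.sqrt 2)⁻¹ : ℝ) else 0

/-- The Choi state `U |Φ⟩_{AA'} ⊗ |Φ⟩_{BB'}`, as a function of the index pairs
`(a, a')` of `AA'` and `(b, b')` of `BB'`. -/
def choi (U : Op) (x y : Fin 2 × Fin 2) : ℂ :=
  ∑ k : Fin 2, ∑ l : Fin 2, U (x.1, y.1) (k, l) * bell k x.2 * bell l y.2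

/-- `s 0 ≥ s 1 ≥ s 2 ≥ s 3` are the Schmidt coefficients of `U`, that is, the coefficients of a
Schmidt decomposition `∑ s_k |e_k⟩ ⊗ |f_k⟩` of its Choi state with respect to the partition
between `AA'` and `BB'`. -/
def IsSchmidtCoeffs (U : Op) (s : Fin 4 → ℝ) : Prop :=
  Antitone s ∧ (∀ k, 0 ≤ s k) ∧
    ∃ e f : Fin 4 → EuclideanSpace ℂ (Fin 2 × Fin 2), Orthonormal ℂ e ∧ Orthonormal ℂ f ∧
      ∀ x y, choi U x y = ∑ k, (s k : ℂ) * e k x * f k y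

end TwoQubit

end

noncomputable section

namespace TwoQubit

open Matrix

/-! ### Vectors and rank-one operators -/

/-! The concurrence form `x ⬝ᵥ (flip₄ *ᵥ x)` is a symmetric quadratic form that vanishes exactly on
product vectors. In the magic basis it is the sum of squares, and its pullback along `U` is given by
a symmetric unitary matrix, which a real orthogonal matrix diagonalizes. Hence there is an
orthonormal basis `T` in which "the input is a product" reads `∑ w i ^ 2 = 0` and "the output is a
product" reads `∑ Δ i * w i ^ 2 = 0` (`exists_diagonal_forms`).

The test states of a reliable protocol span the space: otherwise `U` preceded by a reflection fixing
all of them passes every test (`Reliable.span_eq_top`). Conversely, a product basis whose members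
all overlap with one of them, with gapped output tests, is reliable (`exists_gateProtocol`). A state
can be verified with a gap by one setting only if it is a product, and by two settings always. So at
least four settings are needed, and an ordinary reliable protocol with exactly four is entanglement
free (`four_le_settings`).

Everything depends on whether exactly one `Δ k` differs from a common value `c` of the others
(`IsSpecial`). If so, subtracting `c` times the input equation from the output equation gives `w k =
0`, so entanglement-free test states cannot span; three of them plus one entangling test state give
five settings. If not, a solution `v` of both linear equations with no zero entry exists, and its
entrywise square root with suitable sign changes yields an entanglement-free basis, hence four
settings.

It remains to see that `IsSpecial Δ` is the Schmidt condition (`IsSchmidtCoeffs.isSpecial_iff`). By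
the Cartan decomposition `U` is locally equivalent to a Bell-diagonal unitary with eigenvalues `d`,
`d i ^ 2 = Δ i`, and the Schmidt coefficients are the moduli of its Pauli coefficients, up to
normalization. Their squares are `(2 ± a ± b ± c) / 8`, where `a`, `b`, `c` are sums of real inner
products of the `d i` over the three pairings of four indices; an elementary analysis of these
finishes the proof. -/

theorem star_star_dotProduct {n : Type*} [Fintype n] (v w : n → ℂ) :
    star (star v ⬝ᵥ w) = star w ⬝ᵥ v := by
  rw [star_dotProduct, star_star]

theorem mul_ketbra_mul (A : Op) (ψ : Idx → ℂ) : A * ketbra ψ * Aᴴ = ketbra (A *ᵥ ψ) := by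
  rw [ketbra, ketbra, mul_vecMulVec, vecMulVec_mul, star_mulVec]

theorem ketbra_mulVec (ψ φ : Idx → ℂ) : ketbra ψ *ᵥ φ = (star ψ ⬝ᵥ φ) • ψ := by
  rw [ketbra, vecMulVec_mulVec]; simp

theorem trace_ketbra (ψ : Idx → ℂ) : (ketbra ψ).trace = star ψ ⬝ᵥ ψ := by
  rw [ketbra, trace_vecMulVec, dotProduct_comm]

theorem trace_mul_ketbra (A : Op) (ψ : Idx → ℂ) :
    (A * ketbra ψ).trace = star ψ ⬝ᵥ (A *ᵥ ψ) := by
  rw [ketbra, mul_vecMulVec, trace_vecMulVec, dotProduct_comm]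

theorem ketbra_posSemidef (ψ : Idx → ℂ) : (ketbra ψ).PosSemidef :=
  posSemidef_vecMulVec_self_star ψ

theorem star_mulVec_dotProduct (A : Op) (ψ φ : Idx → ℂ) :
    star (A *ᵥ ψ) ⬝ᵥ φ = star ψ ⬝ᵥ (Aᴴ *ᵥ φ) := by
  rw [star_mulVec, ← dotProduct_mulVec]

theorem inner_unitary {U : Op} (hU : Uᴴ * U = 1) (ψ φ : Idx → ℂ) :
    star (U *ᵥ ψ) ⬝ᵥ (U *ᵥ φ) = star ψ ⬝ᵥ φ := by
  rw [star_mulVec_dotProduct, mulVec_mulVec, hU, one_mulVec]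

theorem IsState.unitary {U : Op} (hU : Uᴴ * U = 1) {ψ : Idx → ℂ} (h : IsState ψ) :
    IsState (U *ᵥ ψ) := by
  unfold IsState; rw [inner_unitary hU]; exact h

theorem IsState.ne_zero {n : Type*} [Fintype n] {ψ : n → ℂ} (h : IsState ψ) : ψ ≠ 0 := by
  rintro rfl
  simp [IsState] at h

theorem isState_tensor {a b : Fin 2 → ℂ} (ha : IsState a) (hb : IsState b) :
    IsState (tensor a b) := by
  unfold IsState dotProduct at *
  simp only [Fin.sum_univ_two, Fintype.sum_prod_type, Pi.star_apply, tensor, star_mul'] at *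
  linear_combination (star (b 0) * b 0 + star (b 1) * b 1) * ha + hb

theorem IsProduct.isState {ψ : Idx → ℂ} (h : IsProduct ψ) : IsState ψ := by
  obtain ⟨a, b, ha, hb, rfl⟩ := h
  exact isState_tensor ha hb

/-! ### Kraus representation -/

theorem linearMap_ext_single (f : Op →ₗ[ℂ] Op) (g : Op →ₗ[ℂ] Op)
    (h : ∀ i j, f (single i j 1) = g (single i j 1)) : f = g := by
  refine LinearMap.ext fun X => ?_
  rw [matrix_eq_sum_single X]
  simp only [map_sum]
  refine Finset.sum_congr rfl fun i _ => Finset.sum_congr rfl fun j _ => ?_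
  have : single i j (X i j) = X i j • single i j (1 : ℂ) := by simp
  rw [this, map_smul, map_smul, h]

/-- Conjugation by a family of operators, as a linear map. -/
def krausMap {ι : Type*} [Fintype ι] (K : ι → Op) : Op →ₗ[ℂ] Op where
  toFun X := ∑ m, K m * X * (K m)ᴴ
  map_add' X Y := by simp [mul_add, add_mul, Finset.sum_add_distrib]
  map_smul' c X := by simp [Finset.smul_sum]

/-- Choi's argument: applying the ampliation of `Λ` to an unnormalized maximally entangled projector
gives a positive matrix `Bᴴ * B`, and the rows of `B`, conjugated and reshaped, are Kraus operators.
-/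
theorem exists_kraus {Λ : Op →ₗ[ℂ] Op} (hΛ : IsChannel Λ) :
    ∃ K : Fin 4 × Idx → Op, (∀ X, Λ X = ∑ m, K m * X * (K m)ᴴ) ∧ ∑ m, (K m)ᴴ * K m = 1 := by
  let e : Idx ≃ Fin 4 := Fintype.equivFinOfCardEq (by simp [Idx])
  let Φ : Fin 4 × Idx → ℂ := fun p => if p.2 = e.symm p.1 then 1 else 0
  have hJ := hΛ.completelyPositive 4 _ (posSemidef_vecMulVec_self_star Φ)
  have hblock : ∀ i j : Idx, (Matrix.of fun a b => vecMulVec Φ (star Φ) (e i, a) (e j, b)) =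
      (single i j 1 : Op) := by
    intro i j
    ext a b
    simp only [of_apply, vecMulVec_apply, Φ, Pi.star_apply, Equiv.symm_apply_apply, single_apply,
      eq_comm (a := i), eq_comm (a := j)]
    by_cases h1 : a = i <;> by_cases h2 : b = j <;> simp [h1, h2]
  open scoped MatrixOrder in
  obtain ⟨B, hB⟩ := CStarAlgebra.nonneg_iff_eq_star_mul_self.mp hJ.nonneg
  let K : Fin 4 × Idx → Op := fun m => Matrix.of fun a i => star (B m (e i, a))
  have hK : ∀ X, Λ X = ∑ m, K m * X * (K m)ᴴ := by
    intro X
    change Λ X = krausMap K X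
    congr 1
    refine linearMap_ext_single _ _ fun i j => ?_
    ext a b
    have := congrFun (congrFun hB (e i, a)) (e j, b)
    simp only [ampliation, of_apply] at this
    rw [hblock] at this
    rw [this]
    simp only [krausMap, LinearMap.coe_mk, AddHom.coe_mk, Matrix.sum_apply, star_eq_conjTranspose,
      mul_apply (M := Bᴴ), conjTranspose_apply]
    refine Finset.sum_congr rfl fun m _ => ?_
    simp [mul_apply, single_apply, K, ite_and]
  refine ⟨K, hK, ?_⟩
  ext i j
  -- Trace preservation on the matrix unit `single j i 1` reads off the `(i, j)` entry of `∑ (K m)ᴴ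
  -- * K m`.
  have h := hΛ.tracePreserving (single j i 1)
  rw [hK, trace_sum] at h
  rw [Matrix.sum_apply]
  have h2 : ∀ m, (K m * single j i 1 * (K m)ᴴ).trace = ((K m)ᴴ * K m) i j := by
    intro m
    rw [trace_mul_comm, ← mul_assoc, trace_mul_comm, trace_single_mul]
    simp
  simp only [h2] at h
  rw [h, one_apply]
  by_cases hij : i = j
  · subst hij; simp
  · simp [hij, trace_single_eq_of_ne _ _ _ (Ne.symm hij)]

/-! ### Identification of unitaries -/

/-- Pure states are extreme: for `χ` orthogonal to `Ψ`, the nonnegative numbers `|⟨χ, φ k⟩|²` sum to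
`|⟨χ, Ψ⟩|² = 0`. This is applied to the component of `φ m` orthogonal to `Ψ`. -/
theorem eq_smul_of_sum_ketbra {ι : Type*} [Fintype ι] {φ : ι → Idx → ℂ} {Ψ : Idx → ℂ}
    (hΨ : IsState Ψ) (h : ∑ m, ketbra (φ m) = ketbra Ψ) (m : ι) :
    φ m = (star Ψ ⬝ᵥ φ m) • Ψ := by
  set χ : Idx → ℂ := φ m - (star Ψ ⬝ᵥ φ m) • Ψ with hχ
  have h0 : star Ψ ⬝ᵥ χ = 0 := by
    rw [hχ, dotProduct_sub, dotProduct_smul, hΨ]; simp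
  have h0' : star χ ⬝ᵥ Ψ = 0 := by rw [← star_star_dotProduct, h0, star_zero]
  have h1 : ∑ k, star χ ⬝ᵥ (ketbra (φ k) *ᵥ χ) = 0 := by
    rw [← dotProduct_sum, ← sum_mulVec, h, ketbra_mulVec, h0]; simp
  have h2 : star χ ⬝ᵥ (ketbra (φ m) *ᵥ χ) = 0 :=
    (Finset.sum_eq_zero_iff_of_nonneg fun k _ =>
      (ketbra_posSemidef (φ k)).dotProduct_mulVec_nonneg χ).mp h1 m (Finset.mem_univ _)
  rw [ketbra_mulVec, dotProduct_smul, ← star_star_dotProduct χ, smul_eq_mul] at h2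
  have h3 : star χ ⬝ᵥ φ m = 0 := by
    rcases mul_eq_zero.mp h2 with h | h
    · exact star_eq_zero.mp h
    · exact h
  have h4 : star χ ⬝ᵥ χ = 0 := by
    conv_lhs => rw [hχ, dotProduct_sub, dotProduct_smul, ← hχ, h3, h0']
    simp
  exact sub_eq_zero.mp (dotProduct_star_self_eq_zero.mp h4)

/-- A channel that agrees with a unitary on a spanning family of pure states, all of which overlap
with one of them, is that unitary. -/
theorem eq_unitary_of_fixed {Λ : Op →ₗ[ℂ] Op} (hΛ : IsChannel Λ) {U : Op} (hU : Uᴴ * U = 1)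
    {n : ℕ} {ψ : Fin n → Idx → ℂ} (hψ : ∀ j, IsState (ψ j))
    (hspan : Submodule.span ℂ (Set.range ψ) = ⊤) (j₀ : Fin n)
    (hov : ∀ j, star (ψ j₀) ⬝ᵥ ψ j ≠ 0)
    (hfix : ∀ j, Λ (ketbra (ψ j)) = ketbra (U *ᵥ ψ j)) (X : Op) : Λ X = U * X * Uᴴ := by
  obtain ⟨K, hK, hK1⟩ := exists_kraus hΛ
  have hc : ∀ j, ∃ c : Fin 4 × Idx → ℂ, ∀ m, K m *ᵥ ψ j = c m • (U *ᵥ ψ j) := by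
    intro j
    have h := hfix j
    rw [hK] at h
    simp only [mul_ketbra_mul] at h
    exact ⟨_, fun m => eq_smul_of_sum_ketbra ((hψ j).unitary hU) h m⟩
  choose c hc using hc
  -- Sandwiching `∑ (K m)ᴴ * K m = 1` between `ψ i` and `ψ j` gives the overlap times the inner
  -- product of `c i` and `c j`; a nonzero overlap cancels.
  have hgram : ∀ i j, star (ψ i) ⬝ᵥ ψ j ≠ 0 → ∑ m, star (c i m) * c j m = 1 := by
    intro i j hij
    have h : ∑ m, star (K m *ᵥ ψ i) ⬝ᵥ (K m *ᵥ ψ j) = star (ψ i) ⬝ᵥ ψ j := by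
      simp only [star_mulVec_dotProduct, mulVec_mulVec]
      rw [← dotProduct_sum, ← sum_mulVec, hK1, one_mulVec]
    simp only [hc, star_smul, smul_dotProduct, dotProduct_smul, inner_unitary hU, smul_eq_mul,
      ← mul_assoc] at h
    rw [← Finset.sum_mul] at h
    simp only [mul_comm (star _)]
    exact mul_right_cancel₀ hij (by rw [h, one_mul])
  have hself : ∀ j, ∑ m, star (c j m) * c j m = 1 := fun j =>
    hgram j j (by rw [hψ j]; exact one_ne_zero)
  -- Two unit vectors with inner product `1` coincide, so every Kraus operator acts as one and the
  -- same multiple of `U` on the whole spanning family.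
  have hconst : ∀ j, c j = c j₀ := by
    intro j
    have h1 := hgram j₀ j (hov j)
    have h2 : ∑ m, star (c j m) * c j₀ m = 1 := by
      have := congrArg star h1
      simpa [mul_comm] using this
    have h3 : star (c j - c j₀) ⬝ᵥ (c j - c j₀) = 0 := by
      have e : star (c j - c j₀) ⬝ᵥ (c j - c j₀) = ∑ m, star (c j m) * c j m
          - ∑ m, star (c j m) * c j₀ m - ∑ m, star (c j₀ m) * c j m
          + ∑ m, star (c j₀ m) * c j₀ m := by
        rw [← Finset.sum_sub_distrib, ← Finset.sum_sub_distrib, ← Finset.sum_add_distrib]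
        refine Finset.sum_congr rfl fun m _ => ?_
        simp only [Pi.star_apply, Pi.sub_apply, star_sub]; ring
      rw [e, hself, hself, h1, h2]; ring
    exact sub_eq_zero.mp (dotProduct_star_self_eq_zero.mp h3)
  have hKU : ∀ m, K m = c j₀ m • U := by
    intro m
    have : (K m).mulVecLin = (c j₀ m • U).mulVecLin := by
      refine LinearMap.ext_on_range hspan fun j => ?_
      simp only [mulVecLin_apply]
      rw [hc, hconst, smul_mulVec]
    exact toLin'.injective this
  rw [hK]
  simp only [hKU, conjTranspose_smul, smul_mul_assoc, mul_smul_comm, smul_smul]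
  rw [← Finset.sum_smul]
  rw [hself j₀, one_smul]

/-! ### Positivity of tests -/

theorem ProjMeas.posSemidef (M : ProjMeas) (a : Fin M.outcomes) : (M.proj a).PosSemidef := by
  have h := M.orthogonal a a
  rw [if_pos rfl] at h
  rw [← h]
  nth_rewrite 1 [← (M.hermitian a).eq]
  exact posSemidef_conjTranspose_mul_self _

theorem sum_kronecker_proj (M N : ProjMeas) :
    ∑ a, ∑ b, M.proj a ⊗ₖ N.proj b = (1 : Op) := by
  rw [← one_kronecker_one]
  nth_rewrite 1 [← M.complete]
  rw [← N.complete]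
  ext i j
  simp only [Matrix.sum_apply, kroneckerMap_apply, Finset.sum_mul_sum]

theorem LocalTest.one_sub_op (T : LocalTest) :
    1 - T.op = ∑ a, ∑ b, ((1 - T.accept a b : ℝ) : ℂ) • (T.measA.proj a ⊗ₖ T.measB.proj b) := by
  rw [← sum_kronecker_proj T.measA T.measB, LocalTest.op]
  simp only [← Finset.sum_sub_distrib, Complex.ofReal_sub, Complex.ofReal_one, sub_smul, one_smul]

theorem LocalTest.posSemidef_one_sub (T : LocalTest) : (1 - T.op).PosSemidef := by
  rw [T.one_sub_op]
  refine posSemidef_sum _ fun a _ => posSemidef_sum _ fun b _ => ?_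
  refine ((T.measA.posSemidef a).kronecker (T.measB.posSemidef b)).smul ?_
  exact_mod_cast sub_nonneg.mpr (T.accept_le_one a b)

theorem LocalTest.proj_mul_op (T : LocalTest) (a : Fin T.measA.outcomes)
    (b : Fin T.measB.outcomes) : (T.measA.proj a ⊗ₖ T.measB.proj b) * T.op =
      (T.accept a b : ℂ) • (T.measA.proj a ⊗ₖ T.measB.proj b) := by
  simp only [LocalTest.op, Finset.mul_sum, mul_smul_comm, ← mul_kronecker_mul,
    T.measA.orthogonal, T.measB.orthogonal]
  rw [Finset.sum_eq_single a, Finset.sum_eq_single b]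
  · simp
  · intro b' _ h; simp [Ne.symm h]
  · simp
  · intro a' _ h; simp [Ne.symm h]
  · simp

theorem LocalTest.op_mul_proj (T : LocalTest) (a : Fin T.measA.outcomes)
    (b : Fin T.measB.outcomes) : T.op * (T.measA.proj a ⊗ₖ T.measB.proj b) =
      (T.accept a b : ℂ) • (T.measA.proj a ⊗ₖ T.measB.proj b) := by
  simp only [LocalTest.op, Finset.sum_mul, smul_mul_assoc, ← mul_kronecker_mul,
    T.measA.orthogonal, T.measB.orthogonal]
  rw [Finset.sum_eq_single a, Finset.sum_eq_single b]
  · simp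
  · intro b' _ h; simp [h]
  · simp
  · intro a' _ h; simp [h]
  · simp

namespace StateProtocol

variable {Ψ : Idx → ℂ}

theorem one_sub_verifOp (S : StateProtocol Ψ) :
    1 - S.verifOp = ∑ l, (S.prob l : ℂ) • (1 - (S.test l).op) := by
  have h : (1 : Op) = ∑ l, (S.prob l : ℂ) • (1 : Op) := by
    rw [← Finset.sum_smul, ← Complex.ofReal_sum, S.prob_sum]; simp
  rw [verifOp, h, ← Finset.sum_sub_distrib]
  simp only [← smul_sub, ← h]

theorem posSemidef_one_sub (S : StateProtocol Ψ) : (1 - S.verifOp).PosSemidef := by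
  rw [S.one_sub_verifOp]
  refine posSemidef_sum _ fun l _ => ((S.test l).posSemidef_one_sub).smul ?_
  exact_mod_cast (S.prob_pos l).le

theorem size_pos (S : StateProtocol Ψ) : 0 < S.size := by
  rcases Nat.eq_zero_or_pos S.size with h | h
  · have := S.prob_sum
    have : IsEmpty (Fin S.size) := by rw [h]; infer_instance
    simp at *
  · exact h

theorem verifOp_mulVec (S : StateProtocol Ψ) : S.verifOp *ᵥ Ψ = Ψ := by
  simp only [verifOp, sum_mulVec, smul_mulVec, S.passes]
  rw [← Finset.sum_smul, ← Complex.ofReal_sum, S.prob_sum]; simp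

/-- `1 - Ω` is a combination of the positive operators `1 - E_l` with positive weights, so its
kernel is the intersection of theirs. -/
theorem mulVec_eq_self_iff (S : StateProtocol Ψ) (φ : Idx → ℂ) :
    S.verifOp *ᵥ φ = φ ↔ ∀ l, (S.test l).op *ᵥ φ = φ := by
  constructor
  · intro h l
    have h1 : ∑ l, star φ ⬝ᵥ (((S.prob l : ℂ) • (1 - (S.test l).op)) *ᵥ φ) = 0 := by
      rw [← dotProduct_sum, ← sum_mulVec, ← S.one_sub_verifOp, sub_mulVec, h]; simp
    have hpsd : ∀ l, ((S.prob l : ℂ) • (1 - (S.test l).op)).PosSemidef := fun l =>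
      ((S.test l).posSemidef_one_sub).smul (by exact_mod_cast (S.prob_pos l).le)
    have h2 := (Finset.sum_eq_zero_iff_of_nonneg fun k _ =>
      (hpsd k).dotProduct_mulVec_nonneg φ).mp h1 l (Finset.mem_univ _)
    rw [(hpsd l).dotProduct_mulVec_zero_iff, smul_mulVec, smul_eq_zero] at h2
    rcases h2 with h2 | h2
    · exact absurd (by exact_mod_cast h2) (S.prob_pos l).ne'
    · rw [sub_mulVec, one_mulVec, sub_eq_zero] at h2
      exact h2.symm
  · intro h
    simp only [verifOp, sum_mulVec, smul_mulVec, h]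
    rw [← Finset.sum_smul, ← Complex.ofReal_sum, S.prob_sum]; simp

end StateProtocol

/-! ### The spectral gap -/

theorem eigenvalue_le_one {H : Op} (h1 : (1 - H).PosSemidef) {r : ℝ} {v : Idx → ℂ} (hv : v ≠ 0)
    (h : H *ᵥ v = (r : ℂ) • v) : r ≤ 1 := by
  have h2 := h1.dotProduct_mulVec_nonneg v
  rw [sub_mulVec, one_mulVec, h, dotProduct_sub, dotProduct_smul, smul_eq_mul] at h2
  have h3 : (0 : ℂ) < star v ⬝ᵥ v := dotProduct_star_self_pos_iff.mpr hv
  have h4 : (0 : ℂ) ≤ ((1 - r : ℝ) : ℂ) * (star v ⬝ᵥ v) := by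
    push_cast; rw [sub_mul, one_mul]; exact h2
  have h5 := (Complex.nonneg_iff.mp h4).1
  rw [Complex.re_ofReal_mul] at h5
  have h6 := (mul_nonneg_iff_of_pos_right (Complex.pos_iff.mp h3).1).mp h5
  linarith

theorem exists_eigenbasis₀ {H : Op} (hH : H.IsHermitian) :
    ∃ v : Fin (Fintype.card Idx) → Idx → ℂ,
      (∀ i j, star (v i) ⬝ᵥ v j = if i = j then 1 else 0) ∧
      (∀ i, H *ᵥ v i = (hH.eigenvalues₀ i : ℂ) • v i) ∧
      ∀ φ, φ = ∑ i, (star (v i) ⬝ᵥ φ) • v i := by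
  let e : Fin (Fintype.card Idx) ≃ Idx := Fintype.equivOfCardEq (Fintype.card_fin _)
  refine ⟨fun i => ⇑(hH.eigenvectorBasis (e i)), ?_, ?_, ?_⟩
  · intro i j
    have := orthonormal_iff_ite.mp hH.eigenvectorBasis.orthonormal (e i) (e j)
    rw [EuclideanSpace.inner_eq_star_dotProduct, dotProduct_comm] at this
    rw [show (star (⇑(hH.eigenvectorBasis (e i))) ⬝ᵥ ⇑(hH.eigenvectorBasis (e j))) = _ from this]
    simp
  · intro i
    have := hH.mulVec_eigenvectorBasis (e i)
    rw [this, IsHermitian.eigenvalues, show (Fintype.equivOfCardEq (Fintype.card_fin _)).symm (e i)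
      = i from e.symm_apply_apply i]
    ext x; simp
  · intro φ
    have := hH.eigenvectorBasis.sum_repr (WithLp.toLp 2 φ)
    have h2 := congrArg (WithLp.ofLp) this
    simp only [WithLp.ofLp_sum, WithLp.ofLp_smul] at h2
    rw [← e.sum_comp] at h2
    rw [← h2]
    refine Finset.sum_congr rfl fun i _ => ?_
    rw [OrthonormalBasis.repr_apply_apply, EuclideanSpace.inner_eq_star_dotProduct,
      dotProduct_comm, h2]

/-- All eigenvalues are at most `1` and `Ψ` has eigenvalue `1`, so the second largest is below `1`
exactly when the eigenvalue `1` is simple. Later arguments use the gap only through this description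
of the fixed space. -/
theorem StateProtocol.spectralGap_pos_iff {Ψ : Idx → ℂ} (hΨ : Ψ ≠ 0) (S : StateProtocol Ψ) :
    0 < S.spectralGap ↔ ∀ φ, S.verifOp *ᵥ φ = φ → ∃ c : ℂ, φ = c • Ψ := by
  have hcard : Fintype.card Idx = 4 := by simp [Idx]
  obtain ⟨v, hon, hev, hex⟩ := exists_eigenbasis₀ S.verifOp_isHermitian
  set μ := S.verifOp_isHermitian.eigenvalues₀ with hμ
  have hanti : Antitone μ := S.verifOp_isHermitian.eigenvalues₀_antitone
  have hne : ∀ i, v i ≠ 0 := by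
    intro i h
    have := hon i i
    simp [h] at this
  let i₀ : Fin (Fintype.card Idx) := ⟨0, by omega⟩
  let i₁ : Fin (Fintype.card Idx) := ⟨1, by omega⟩
  have hgap : S.spectralGap = 1 - μ i₁ := rfl
  have hle : ∀ i, μ i ≤ 1 := fun i => eigenvalue_le_one S.posSemidef_one_sub (hne i) (hev i)
  rw [hgap]
  constructor
  · intro hpos
    have key : ∀ φ, S.verifOp *ᵥ φ = φ → φ = (star (v i₀) ⬝ᵥ φ) • v i₀ := by
      intro φ hφ
      conv_lhs => rw [hex φ]
      refine Finset.sum_eq_single i₀ (fun i _ hi => ?_) (by simp)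
      have hi1 : i₁ ≤ i := by
        have : (i : ℕ) ≠ 0 := fun h => hi (Fin.ext h)
        exact Fin.mk_le_of_le_val (by omega)
      have hlt : μ i < 1 := lt_of_le_of_lt (hanti hi1) (by linarith)
      have h1 : star (v i) ⬝ᵥ φ = (μ i : ℂ) * (star (v i) ⬝ᵥ φ) := by
        conv_lhs => rw [← hφ]
        rw [← (S.verifOp_isHermitian).eq, ← star_mulVec_dotProduct, hev, star_smul,
          smul_dotProduct, smul_eq_mul]
        simp
      have h2 : ((1 - μ i : ℝ) : ℂ) * (star (v i) ⬝ᵥ φ) = 0 := by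
        push_cast; linear_combination h1
      rcases mul_eq_zero.mp h2 with h | h
      · have : 1 - μ i = 0 := by exact_mod_cast h
        linarith
      · rw [h, zero_smul]
    intro φ hφ
    have hΨ' := key Ψ S.verifOp_mulVec
    have hc : star (v i₀) ⬝ᵥ Ψ ≠ 0 := by
      intro h; rw [h, zero_smul] at hΨ'; exact hΨ hΨ'
    refine ⟨(star (v i₀) ⬝ᵥ φ) / (star (v i₀) ⬝ᵥ Ψ), ?_⟩
    have h3 : v i₀ = (star (v i₀) ⬝ᵥ Ψ)⁻¹ • Ψ := by
      conv_rhs => rw [hΨ', dotProduct_smul, hon, if_pos rfl]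
      simp [smul_smul, inv_mul_cancel₀ hc]
    rw [key φ hφ, dotProduct_smul, hon, if_pos rfl, smul_eq_mul, mul_one, div_eq_mul_inv, mul_smul,
      ← h3]
  · intro h
    by_contra hcon
    have h1 : μ i₁ = 1 := le_antisymm (hle _) (by linarith)
    -- Without a gap the two leading eigenvalues are both `1`, and two orthonormal eigenvectors
    -- would be multiples of the same `Ψ`.
    have h0 : μ i₀ = 1 := le_antisymm (hle _) (h1 ▸ hanti (Fin.mk_le_of_le_val (by simp [i₁])))
    obtain ⟨c, hc⟩ := h (v i₀) (by rw [hev, h0]; simp)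
    obtain ⟨d, hd⟩ := h (v i₁) (by rw [hev, h1]; simp)
    have horth := hon i₀ i₁
    rw [if_neg (by simp [i₀, i₁]), hc, hd, star_smul, smul_dotProduct, dotProduct_smul] at horth
    have hΨΨ : star Ψ ⬝ᵥ Ψ ≠ 0 := (dotProduct_star_self_pos_iff.mpr hΨ).ne'
    simp only [smul_eq_mul, mul_eq_zero, hΨΨ, or_false] at horth
    rcases horth with h | h
    · exact hne i₀ (by rw [hc, star_eq_zero.mp h, zero_smul])
    · exact hne i₁ (by rw [hd, h, zero_smul])

/-- Write `ρ = Bᴴ * B`. Passing with certainty means `B * (1 - Ω) * Bᴴ` is positive of trace zero,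
so `Ω` fixes each column of `Bᴴ`; the gap makes these columns multiples of `Ψ`. -/
theorem StateProtocol.eq_ketbra {Ψ : Idx → ℂ} (hΨ : IsState Ψ) (S : StateProtocol Ψ)
    (hS : 0 < S.spectralGap) {ρ : Op} (hρ : ρ.PosSemidef) (htr : ρ.trace = 1)
    (hpass : (S.verifOp * ρ).trace = 1) : ρ = ketbra Ψ := by
  rw [S.spectralGap_pos_iff hΨ.ne_zero] at hS
  open scoped MatrixOrder in
  obtain ⟨B, hB⟩ := CStarAlgebra.nonneg_iff_eq_star_mul_self.mp hρ.nonneg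
  rw [star_eq_conjTranspose] at hB
  have h0 : ((1 - S.verifOp) * ρ).trace = 0 := by
    rw [sub_mul, one_mul, trace_sub, htr, hpass, sub_self]
  have h1 : (B * (1 - S.verifOp) * Bᴴ).trace = 0 := by
    rw [trace_mul_comm, ← mul_assoc, ← hB, trace_mul_comm]; exact h0
  have hvec : ∀ i, ∃ c : ℂ, Bᴴ *ᵥ Pi.single i 1 = c • Ψ := by
    intro i
    apply hS
    have hp := S.posSemidef_one_sub.mul_mul_conjTranspose_same B
    have h2 : (B * (1 - S.verifOp) * Bᴴ) i i = 0 :=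
      (Finset.sum_eq_zero_iff_of_nonneg fun k _ => hp.diag_nonneg (i := k)).mp h1 i
        (Finset.mem_univ _)
    have h3 : star (Bᴴ *ᵥ Pi.single i 1) ⬝ᵥ ((1 - S.verifOp) *ᵥ (Bᴴ *ᵥ Pi.single i 1)) = 0 := by
      rw [star_mulVec_dotProduct, conjTranspose_conjTranspose, mulVec_mulVec, mulVec_mulVec]
      rw [← h2]; simp
    rw [S.posSemidef_one_sub.dotProduct_mulVec_zero_iff, sub_mulVec, one_mulVec, sub_eq_zero] at h3
    exact h3.symm
  choose c hc using hvec
  have hBe : Bᴴ = vecMulVec Ψ c := by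
    ext x i
    have := congrFun (hc i) x
    simp only [mulVec_single_one, col_apply, Pi.smul_apply, smul_eq_mul] at this
    rw [this, vecMulVec_apply, mul_comm]
  have h4 : ρ = (c ⬝ᵥ star c) • ketbra Ψ := by
    have hB2 : B = vecMulVec (star c) (star Ψ) := by
      rw [← conjTranspose_conjTranspose B, hBe, conjTranspose_vecMulVec]
    rw [hB, hBe, hB2, vecMulVec_mul_vecMulVec, ketbra, vecMulVec_smul]
  rw [h4, trace_smul, trace_ketbra, hΨ, smul_eq_mul, mul_one] at htr
  rw [h4, htr, one_smul]

/-! ### One-qubit bases -/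

/-- The projective measurement in the orthonormal basis formed by the columns of `W`. -/
def basisMeas (W : Matrix (Fin 2) (Fin 2) ℂ) (hW : Wᴴ * W = 1) : ProjMeas where
  outcomes := 2
  proj i := vecMulVec (W.col i) (star (W.col i))
  hermitian i := (posSemidef_vecMulVec_self_star (W.col i)).isHermitian
  orthogonal i j := by
    have h : star (W.col i) ⬝ᵥ W.col j = if i = j then 1 else 0 := by
      have := congrFun (congrFun hW i) j
      rwa [mul_apply, one_apply] at this
    rw [vecMulVec_mul_vecMulVec, h]
    split_ifs with hij
    · subst hij; simp
    · simp
  complete := by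
    rw [← mul_eq_one_comm.mp hW]
    ext x y
    rw [Matrix.sum_apply, mul_apply]
    rfl

/-- The special unitary matrix with a given first column. -/
def su2 (a : Fin 2 → ℂ) : Matrix (Fin 2) (Fin 2) ℂ := !![a 0, -star (a 1); a 1, star (a 0)]

theorem isState_fin_two {a : Fin 2 → ℂ} : IsState a ↔ star (a 0) * a 0 + star (a 1) * a 1 = 1 := by
  simp [IsState, dotProduct]

theorem su2_unitary {a : Fin 2 → ℂ} (ha : IsState a) : (su2 a)ᴴ * su2 a = 1 := by
  rw [isState_fin_two] at ha
  ext i j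
  fin_cases i <;> fin_cases j <;> simp [su2, mul_apply] <;> simp at ha <;> first
    | ring1
    | linear_combination ha

theorem su2_col_zero (a : Fin 2 → ℂ) : (su2 a).col 0 = a := by
  ext i; fin_cases i <;> simp [su2]

theorem star_tensor_dotProduct (a b c d : Fin 2 → ℂ) :
    star (tensor a b) ⬝ᵥ tensor c d = (star a ⬝ᵥ c) * (star b ⬝ᵥ d) := by
  simp [dotProduct, Fintype.sum_prod_type, tensor]
  ring

theorem kronecker_mulVec_tensor (A B : Matrix (Fin 2) (Fin 2) ℂ) (a b : Fin 2 → ℂ) :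
    (A ⊗ₖ B) *ᵥ tensor a b = tensor (A *ᵥ a) (B *ᵥ b) := by
  ext ⟨i, j⟩
  simp [mulVec, dotProduct, Fintype.sum_prod_type, tensor]
  ring

theorem kronecker_ketbra (a b : Fin 2 → ℂ) :
    vecMulVec a (star a) ⊗ₖ vecMulVec b (star b) = ketbra (tensor a b) := by
  ext i j
  simp [ketbra, vecMulVec_apply, tensor]
  ring

/-- The local test in a product basis with given acceptance probabilities. -/
def basisTest (W V : Matrix (Fin 2) (Fin 2) ℂ) (hW : Wᴴ * W = 1) (hV : Vᴴ * V = 1)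
    (f : Fin 2 → Fin 2 → ℝ) (hf0 : ∀ i j, 0 ≤ f i j) (hf1 : ∀ i j, f i j ≤ 1) : LocalTest where
  measA := basisMeas W hW
  measB := basisMeas V hV
  accept := f
  accept_nonneg := hf0
  accept_le_one := hf1

theorem basisTest_op (W V : Matrix (Fin 2) (Fin 2) ℂ) (hW : Wᴴ * W = 1) (hV : Vᴴ * V = 1)
    (f : Fin 2 → Fin 2 → ℝ) (hf0 : ∀ i j, 0 ≤ f i j) (hf1 : ∀ i j, f i j ≤ 1) :
    (basisTest W V hW hV f hf0 hf1).op =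
      ∑ i, ∑ j, (f i j : ℂ) • ketbra (tensor (W.col i) (V.col j)) := by
  simp only [← kronecker_ketbra]
  rfl

theorem sum_ketbra_tensor {W V : Matrix (Fin 2) (Fin 2) ℂ} (hW : Wᴴ * W = 1) (hV : Vᴴ * V = 1) :
    ∑ i, ∑ j, ketbra (tensor (W.col i) (V.col j)) = 1 := by
  simp only [← kronecker_ketbra]
  exact sum_kronecker_proj (basisMeas W hW) (basisMeas V hV)

theorem exists_acceptTest {a b : Fin 2 → ℂ} (ha : IsState a) (hb : IsState b) :
    ∃ T : LocalTest, T.op = ketbra (tensor a b) := by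
  refine ⟨basisTest (su2 a) (su2 b) (su2_unitary ha) (su2_unitary hb)
    (fun i j => if i = 0 ∧ j = 0 then 1 else 0) (fun i j => by positivity)
    (fun i j => by split_ifs <;> norm_num), ?_⟩
  rw [basisTest_op]
  simp [Fin.sum_univ_two, su2_col_zero]

theorem exists_excludeTest {a b : Fin 2 → ℂ} (ha : IsState a) (hb : IsState b) :
    ∃ T : LocalTest, T.op = 1 - ketbra (tensor a b) := by
  refine ⟨basisTest (su2 a) (su2 b) (su2_unitary ha) (su2_unitary hb)
    (fun i j => if i = 0 ∧ j = 0 then 0 else 1) (fun i j => by positivity)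
    (fun i j => by split_ifs <;> norm_num), ?_⟩
  rw [basisTest_op, ← sum_ketbra_tensor (su2_unitary ha) (su2_unitary hb)]
  simp [Fin.sum_univ_two, su2_col_zero]
  abel

theorem exists_correlationTest {W V : Matrix (Fin 2) (Fin 2) ℂ} (hW : Wᴴ * W = 1)
    (hV : Vᴴ * V = 1) : ∃ T : LocalTest, T.op =
      ketbra (tensor (W.col 0) (V.col 0)) + ketbra (tensor (W.col 1) (V.col 1)) := by
  refine ⟨basisTest W V hW hV (fun i j => if i = j then 1 else 0) (fun i j => by positivity)
    (fun i j => by split_ifs <;> norm_num), ?_⟩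
  rw [basisTest_op]
  simp [Fin.sum_univ_two]

/-! ### Schmidt decomposition of two-qubit states -/

theorem exists_isState_smul {n : Type*} [Fintype n] {r : n → ℂ} (hr : r ≠ 0) :
    ∃ (u : n → ℂ) (c : ℂ), IsState u ∧ c ≠ 0 ∧ r = c • u := by
  have h0 : (0 : ℂ) < star r ⬝ᵥ r := dotProduct_star_self_pos_iff.mpr hr
  obtain ⟨h1, h2⟩ := Complex.pos_iff.mp h0
  set t : ℝ := (star r ⬝ᵥ r).re with ht
  have h3 : star r ⬝ᵥ r = (t : ℂ) := by
    apply Complex.ext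
    · simp [ht]
    · rw [← h2]; simp
  have hs : ((Real.sqrt t : ℝ) : ℂ) ≠ 0 := by
    exact_mod_cast (Real.sqrt_pos.mpr h1).ne'
  refine ⟨((Real.sqrt t : ℝ) : ℂ)⁻¹ • r, (Real.sqrt t : ℝ), ?_, hs, ?_⟩
  · rw [IsState, star_smul, smul_dotProduct, dotProduct_smul, h3]
    have : ((Real.sqrt t : ℝ) : ℂ) * (Real.sqrt t : ℝ) = t := by
      exact_mod_cast Real.mul_self_sqrt h1.le
    rw [star_inv₀, Complex.star_def, Complex.conj_ofReal]
    simp only [smul_eq_mul]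
    rw [← this]
    field_simp
  · rw [smul_smul, mul_inv_cancel₀ hs, one_smul]

theorem exists_isState_orthogonal (r : Fin 2 → ℂ) :
    ∃ u : Fin 2 → ℂ, IsState u ∧ star u ⬝ᵥ r = 0 := by
  by_cases hr : r = 0
  · exact ⟨![1, 0], by simp [isState_fin_two], by simp [hr]⟩
  · have hp : ![-star (r 1), star (r 0)] ≠ 0 := by
      intro h
      apply hr
      have h0 := congrFun h 0
      have h1 := congrFun h 1
      simp at h0 h1
      ext i; fin_cases i <;> simp [h0, h1]
    obtain ⟨u, c, hu, hc, h⟩ := exists_isState_smul hp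
    refine ⟨u, hu, ?_⟩
    have : star ![-star (r 1), star (r 0)] ⬝ᵥ r = 0 := by
      simp [dotProduct]; ring
    rw [h, star_smul, smul_dotProduct, smul_eq_zero, star_eq_zero] at this
    exact this.resolve_left hc

theorem expand_su2 {u : Fin 2 → ℂ} (hu : IsState u) (r : Fin 2 → ℂ) :
    r = (star u ⬝ᵥ r) • (su2 u).col 0 + (star ((su2 u).col 1) ⬝ᵥ r) • (su2 u).col 1 := by
  rw [isState_fin_two] at hu
  simp at hu
  ext i
  fin_cases i <;> simp [su2, dotProduct]
  · linear_combination (-r 0) * hu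
  · linear_combination (-r 1) * hu

/-- If `W` diagonalizes `m * mᴴ`, with `m` the coefficient matrix, the rows of `Wᴴ * m` are
orthogonal. Normalizing the first and completing it by `su2` puts the second along the second
column. -/
theorem exists_schmidt (Ψ : Idx → ℂ) : ∃ (W V : Matrix (Fin 2) (Fin 2) ℂ) (α β : ℂ),
    Wᴴ * W = 1 ∧ Vᴴ * V = 1 ∧
    Ψ = α • tensor (W.col 0) (V.col 0) + β • tensor (W.col 1) (V.col 1) := by
  let m : Matrix (Fin 2) (Fin 2) ℂ := Matrix.of fun i j => Ψ (i, j)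
  have hH : (m * mᴴ).IsHermitian := isHermitian_mul_conjTranspose_self m
  let W : Matrix (Fin 2) (Fin 2) ℂ := hH.eigenvectorUnitary
  have hW : Wᴴ * W = 1 := Unitary.coe_star_mul_self hH.eigenvectorUnitary
  have hW' : W * Wᴴ = 1 := mul_eq_one_comm.mp hW
  have hspec : m * mᴴ * W = W * diagonal (RCLike.ofReal ∘ hH.eigenvalues) := by
    have h := hH.spectral_theorem
    rw [Unitary.conjStarAlgAut_apply] at h
    have h2 : m * mᴴ = W * diagonal (RCLike.ofReal ∘ hH.eigenvalues) * Wᴴ := h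
    have h3 := congrArg (· * W) h2
    simpa only [mul_assoc _ Wᴴ W, hW, mul_one] using h3
  have hdiag : (Wᴴ * m) * (Wᴴ * m)ᴴ = diagonal (RCLike.ofReal ∘ hH.eigenvalues) := by
    rw [conjTranspose_mul, conjTranspose_conjTranspose, mul_assoc, ← mul_assoc m, hspec,
      ← mul_assoc, hW, one_mul]
  let r : Fin 2 → Fin 2 → ℂ := fun i => (Wᴴ * m) i
  have horth : star (r 0) ⬝ᵥ r 1 = 0 := by
    have h := congrFun (congrFun hdiag 1) 0
    rw [mul_apply, diagonal_apply_ne _ (by decide)] at h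
    rw [← h]
    simp only [dotProduct, conjTranspose_apply, r, Pi.star_apply]
    exact Finset.sum_congr rfl fun k _ => mul_comm _ _
  have hΨ : Ψ = tensor (W.col 0) (r 0) + tensor (W.col 1) (r 1) := by
    have h : m = W * (Wᴴ * m) := by rw [← mul_assoc, hW', one_mul]
    ext ⟨i, j⟩
    have := congrFun (congrFun h i) j
    rw [mul_apply, Fin.sum_univ_two] at this
    exact this
  -- If the first row vanishes it gives no direction; any unit vector orthogonal to the second row
  -- will do.
  have hu : ∃ (u : Fin 2 → ℂ) (α : ℂ), IsState u ∧ r 0 = α • u ∧ star u ⬝ᵥ r 1 = 0 := by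
    by_cases h0 : r 0 = 0
    · obtain ⟨u, hu, h⟩ := exists_isState_orthogonal (r 1)
      exact ⟨u, 0, hu, by simp [h0], h⟩
    · obtain ⟨u, c, hu, hc, h⟩ := exists_isState_smul h0
      refine ⟨u, c, hu, h, ?_⟩
      rw [h, star_smul, smul_dotProduct, smul_eq_zero, star_eq_zero] at horth
      exact horth.resolve_left hc
  obtain ⟨u, α, hu, h0, h1⟩ := hu
  refine ⟨W, su2 u, α, star ((su2 u).col 1) ⬝ᵥ r 1, hW, su2_unitary hu, ?_⟩
  have h2 := expand_su2 hu (r 1)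
  rw [h1, zero_smul, zero_add] at h2
  rw [su2_col_zero]
  conv_lhs => rw [hΨ, h0, h2]
  ext p
  simp only [tensor, Pi.add_apply, Pi.smul_apply, smul_eq_mul]
  ring

/-! ### State verification with one and two settings -/

theorem exists_protocol_of_isProduct {Ψ : Idx → ℂ} (h : IsProduct Ψ) :
    ∃ S : StateProtocol Ψ, S.size = 1 ∧ 0 < S.spectralGap := by
  have hs := h.isState
  obtain ⟨a, b, ha, hb, hab⟩ := h
  obtain ⟨T, hT⟩ := exists_acceptTest ha hb
  rw [← hab] at hT
  let S : StateProtocol Ψ :=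
    { size := 1
      test := fun _ => T
      prob := fun _ => 1
      prob_pos := fun _ => one_pos
      prob_sum := by simp
      passes := fun _ => by rw [hT, ketbra_mulVec, hs, one_smul] }
  refine ⟨S, rfl, (S.spectralGap_pos_iff hs.ne_zero).mpr fun φ hφ => ?_⟩
  have := (S.mulVec_eq_self_iff φ).mp hφ 0
  rw [show (S.test 0).op = ketbra Ψ from hT, ketbra_mulVec] at this
  exact ⟨_, this.symm⟩

/-- The correlation test in the Schmidt basis confines the fixed vectors to the plane spanned by `e`
and `f`. The second test excludes one product vector orthogonal to `Ψ` but not to that plane, so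
only the line of `Ψ` remains. -/
theorem exists_protocol_of_isState {Ψ : Idx → ℂ} (h : IsState Ψ) :
    ∃ S : StateProtocol Ψ, S.size = 2 ∧ 0 < S.spectralGap := by
  obtain ⟨W, V, α, β, hW, hV, hΨ⟩ := exists_schmidt Ψ
  have hWc : ∀ i j, star (W.col i) ⬝ᵥ W.col j = if i = j then 1 else 0 := fun i j => by
    have := congrFun (congrFun hW i) j
    rwa [mul_apply, one_apply] at this
  have hVc : ∀ i j, star (V.col i) ⬝ᵥ V.col j = if i = j then 1 else 0 := fun i j => by
    have := congrFun (congrFun hV i) j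
    rwa [mul_apply, one_apply] at this
  set e := tensor (W.col 0) (V.col 0) with he
  set f := tensor (W.col 1) (V.col 1) with hf
  have hee : star e ⬝ᵥ e = 1 := by rw [he, star_tensor_dotProduct, hWc, hVc]; simp
  have hff : star f ⬝ᵥ f = 1 := by rw [hf, star_tensor_dotProduct, hWc, hVc]; simp
  have hef : star e ⬝ᵥ f = 0 := by rw [he, hf, star_tensor_dotProduct, hWc]; simp
  have hfe : star f ⬝ᵥ e = 0 := by rw [he, hf, star_tensor_dotProduct, hWc]; simp
  have hnorm : star α * α + star β * β = 1 := by
    have := h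
    rw [IsState, hΨ] at this
    simp only [star_add, star_smul, add_dotProduct, dotProduct_add, smul_dotProduct,
      dotProduct_smul, hee, hff, hef, hfe, smul_eq_mul] at this
    linear_combination this
  have hsq : ((Real.sqrt 2 : ℝ) : ℂ) * (Real.sqrt 2 : ℝ) = 2 := by
    exact_mod_cast Real.mul_self_sqrt (by norm_num : (0 : ℝ) ≤ 2)
  have hs0 : ((Real.sqrt 2 : ℝ) : ℂ) ≠ 0 := fun h0 => by simp [h0] at hsq
  set s : ℂ := ((Real.sqrt 2 : ℝ) : ℂ)⁻¹ with hsdef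
  have hss : s * s = 1 / 2 := by rw [hsdef, ← mul_inv, hsq]; norm_num
  have hsr : star s = s := by simp [hsdef]
  -- With this choice `a ⊗ b` has overlaps `s * β` and `-(s * α)` with `e` and `f`, which cancel
  -- against the Schmidt coefficients of `Ψ`.
  set a : Fin 2 → ℂ := s • W.col 0 + s • W.col 1 with hadef
  set b : Fin 2 → ℂ := star β • V.col 0 - star α • V.col 1 with hbdef
  have ha : IsState a := by
    simp only [IsState, hadef, star_add, star_smul, add_dotProduct, dotProduct_add,
      smul_dotProduct, dotProduct_smul, hWc, smul_eq_mul, hsr]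
    simp
    linear_combination 2 * hss
  have hb : IsState b := by
    simp only [IsState, hbdef, star_sub, star_smul, sub_dotProduct, dotProduct_sub,
      smul_dotProduct, dotProduct_smul, hVc, smul_eq_mul, star_star]
    simp at hnorm ⊢
    linear_combination hnorm
  have habe : star (tensor a b) ⬝ᵥ e = s * β := by
    rw [he, star_tensor_dotProduct]
    simp only [hadef, hbdef, star_add, star_sub, star_smul, add_dotProduct, sub_dotProduct,
      smul_dotProduct, hWc, hVc, hsr, star_star]
    simp
  have habf : star (tensor a b) ⬝ᵥ f = - (s * α) := by
    rw [hf, star_tensor_dotProduct]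
    simp only [hadef, hbdef, star_add, star_sub, star_smul, add_dotProduct, sub_dotProduct,
      smul_dotProduct, hWc, hVc, hsr, star_star]
    simp
  obtain ⟨T₁, hT₁⟩ := exists_correlationTest hW hV
  obtain ⟨T₂, hT₂⟩ := exists_excludeTest ha hb
  rw [← he, ← hf] at hT₁
  have hpass : ∀ l : Fin 2, (![T₁, T₂] l).op *ᵥ Ψ = Ψ := by
    intro l
    fin_cases l
    · simp only [Fin.zero_eta, cons_val_zero]
      rw [hT₁, hΨ, add_mulVec, ketbra_mulVec, ketbra_mulVec]
      simp only [dotProduct_add, dotProduct_smul, hee, hff, hef, hfe]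
      simp
    · simp only [Fin.mk_one, cons_val_one, cons_val_zero]
      rw [hT₂, sub_mulVec, one_mulVec, ketbra_mulVec, hΨ, dotProduct_add, dotProduct_smul,
        dotProduct_smul, habe, habf, sub_eq_self, smul_eq_mul, smul_eq_mul]
      rw [show α * (s * β) + β * -(s * α) = 0 by ring, zero_smul]
  let S : StateProtocol Ψ :=
    { size := 2
      test := ![T₁, T₂]
      prob := fun _ => 1 / 2
      prob_pos := fun _ => by norm_num
      prob_sum := by simp
      passes := hpass }
  refine ⟨S, rfl, (S.spectralGap_pos_iff h.ne_zero).mpr fun φ hφ => ?_⟩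
  have hfix := (S.mulVec_eq_self_iff φ).mp hφ
  have h1 : T₁.op *ᵥ φ = φ := hfix 0
  have h2 : T₂.op *ᵥ φ = φ := hfix 1
  rw [hT₁, add_mulVec, ketbra_mulVec, ketbra_mulVec] at h1
  rw [hT₂, sub_mulVec, one_mulVec, ketbra_mulVec, sub_eq_self, smul_eq_zero] at h2
  have h3 := h2.resolve_right (isState_tensor ha hb).ne_zero
  set γ := star e ⬝ᵥ φ
  set δ := star f ⬝ᵥ φ
  rw [← h1, dotProduct_add, dotProduct_smul, dotProduct_smul, habe, habf, smul_eq_mul,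
    smul_eq_mul] at h3
  have hs : s ≠ 0 := inv_ne_zero hs0
  have h4 : γ * β = δ * α := by
    apply mul_left_cancel₀ hs
    linear_combination h3
  refine ⟨γ * star α + δ * star β, ?_⟩
  rw [← h1, hΨ, smul_add, smul_smul, smul_smul]
  congr 2
  · linear_combination (-γ) * hnorm + star β * h4
  · linear_combination (-δ) * hnorm - star α * h4

/-- A state that can be verified with a single setting is a product state. -/
theorem StateProtocol.isProduct_of_size_eq_one {Ψ : Idx → ℂ} (hΨ : IsState Ψ)
    (S : StateProtocol Ψ) (hS : S.size = 1) (hgap : 0 < S.spectralGap) : IsProduct Ψ := by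
  rw [S.spectralGap_pos_iff hΨ.ne_zero] at hgap
  let l : Fin S.size := ⟨0, by omega⟩
  have hl : ∀ k, k = l := fun k => Fin.ext (by have := k.2; simp only [l]; omega)
  set T := S.test l with hT
  have hgap' : ∀ φ, T.op *ᵥ φ = φ → ∃ c : ℂ, φ = c • Ψ := fun φ hφ =>
    hgap φ ((S.mulVec_eq_self_iff φ).mpr fun k => by rw [hl k]; exact hφ)
  have hex : ∃ a b, (T.measA.proj a ⊗ₖ T.measB.proj b) *ᵥ Ψ ≠ 0 := by
    by_contra! hcon
    apply hΨ.ne_zero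
    rw [← one_mulVec Ψ, ← sum_kronecker_proj T.measA T.measB]
    simp [sum_mulVec, hcon]
  obtain ⟨a, b, hab⟩ := hex
  -- An outcome pair that occurs on `Ψ` must be accepted with certainty. The test then fixes the
  -- whole range of this product projector, which contains a nonzero product vector; by the gap, `Ψ`
  -- is proportional to it.
  have hacc : (T.accept a b : ℂ) = 1 := by
    have h1 : (T.measA.proj a ⊗ₖ T.measB.proj b) *ᵥ (T.op *ᵥ Ψ) =
        (T.measA.proj a ⊗ₖ T.measB.proj b) *ᵥ Ψ := by rw [S.passes l]
    rw [mulVec_mulVec, T.proj_mul_op, smul_mulVec] at h1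
    have h2 : ((T.accept a b : ℂ) - 1) • ((T.measA.proj a ⊗ₖ T.measB.proj b) *ᵥ Ψ) = 0 := by
      rw [sub_smul, one_smul, h1, sub_self]
    exact sub_eq_zero.mp ((smul_eq_zero.mp h2).resolve_right hab)
  have hne : ∀ P : Matrix (Fin 2) (Fin 2) ℂ, P ≠ 0 → ∃ x, P *ᵥ x ≠ 0 := by
    intro P hP
    by_contra! hcon
    exact hP (toLin'.injective (LinearMap.ext fun x => by simpa using hcon x))
  have hA : T.measA.proj a ≠ 0 := by
    intro h; rw [h] at hab; simp at hab
  have hB : T.measB.proj b ≠ 0 := by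
    intro h; rw [h] at hab; simp at hab
  obtain ⟨x, hx⟩ := hne _ hA
  obtain ⟨y, hy⟩ := hne _ hB
  obtain ⟨c, hc⟩ := hgap' (tensor (T.measA.proj a *ᵥ x) (T.measB.proj b *ᵥ y)) (by
    rw [← kronecker_mulVec_tensor, mulVec_mulVec, T.op_mul_proj, hacc, one_smul])
  obtain ⟨u, p, hu, hp, hxu⟩ := exists_isState_smul hx
  obtain ⟨v, q, hv, hq, hyv⟩ := exists_isState_smul hy
  have h1 : (p * q) • tensor u v = c • Ψ := by
    rw [← hc, hxu, hyv]
    ext k; simp [tensor]; ring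
  have h2 : Ψ = (c⁻¹ * (p * q)) • tensor u v := by
    have hc0 : c ≠ 0 := by
      rintro rfl
      rw [zero_smul, smul_eq_zero] at h1
      exact h1.elim (mul_ne_zero hp hq) (isState_tensor hu hv).ne_zero
    rw [mul_smul, h1, smul_smul, inv_mul_cancel₀ hc0, one_smul]
  set t := c⁻¹ * (p * q)
  have ht : star t * t = 1 := by
    have h3 := hΨ
    rw [IsState, h2, star_smul, smul_dotProduct, dotProduct_smul, isState_tensor hu hv] at h3
    simpa using h3
  refine ⟨t • u, v, ?_, hv, ?_⟩
  · rw [IsState, star_smul, smul_dotProduct, dotProduct_smul, hu]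
    simpa using ht
  · rw [h2]; ext k; simp [tensor]; ring

/-! ### Gate protocols from test states -/

theorem ketbra_eq_imp {ψ φ : Idx → ℂ} (hφ : IsState φ) (h : ketbra ψ = ketbra φ) :
    ∃ c : ℂ, φ = c • ψ := by
  refine ⟨star ψ ⬝ᵥ φ, ?_⟩
  rw [← ketbra_mulVec, h, ketbra_mulVec, hφ, one_smul]

/-- Four product test states which form a basis and all overlap with one of them, together with
verification protocols with positive spectral gap for the output states, form an ordinary protocol
that verifies `U` reliably. -/
theorem exists_gateProtocol {U : Op} (hU : Uᴴ * U = 1) {ψ : Fin 4 → Idx → ℂ}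
    (hprod : ∀ j, IsProduct (ψ j)) (hspan : Submodule.span ℂ (Set.range ψ) = ⊤) (j₀ : Fin 4)
    (hov : ∀ j, star (ψ j₀) ⬝ᵥ ψ j ≠ 0) (S : ∀ j, StateProtocol (U *ᵥ ψ j))
    (hS : ∀ j, 0 < (S j).spectralGap) :
    ∃ P : GateProtocol U, P.Ordinary ∧ P.Reliable ∧ P.settings = ∑ j, (S j).size ∧
      ((∀ j, IsProduct (U *ᵥ ψ j)) → P.EntanglementFree) := by
  have hst : ∀ j, IsState (ψ j) := fun j => (hprod j).isState
  have hli : LinearIndependent ℂ ψ :=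
    linearIndependent_of_top_le_span_of_card_eq_finrank hspan.ge (by simp [Idx])
  let P : GateProtocol U :=
    { size := 4
      input := ψ
      input_product := hprod
      input_distinct := fun i j hij => by
        by_contra hne
        obtain ⟨c, hc⟩ := ketbra_eq_imp (hst j) hij
        have h := Fintype.linearIndependent_iff.mp hli (c • Pi.single i 1 - Pi.single j 1)
          (by simp [sub_smul, Finset.sum_sub_distrib, Pi.single_apply, hc]) j
        simp [Ne.symm hne] at h
      prob := fun _ => 1 / 4
      prob_pos := fun _ => by norm_num
      prob_sum := by simp
      output := S }
  refine ⟨P, hS, fun Λ hΛ hpass ρ _ => ?_, rfl, fun h j => ⟨hprod j, h j⟩⟩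
  refine eq_unitary_of_fixed hΛ hU hst hspan j₀ hov (fun j => ?_) ρ
  -- Positivity of `Λ` is complete positivity at `k = 1`.
  have hpsd : (Λ (ketbra (ψ j))).PosSemidef := by
    have h := hΛ.completelyPositive 1
      (Matrix.of fun p q : Fin 1 × Idx => ketbra (ψ j) p.2 q.2)
      ((ketbra_posSemidef (ψ j)).submatrix Prod.snd)
    exact h.submatrix (fun i : Idx => ((0 : Fin 1), i))
  refine (S j).eq_ketbra ((hst j).unitary hU) (hS j) hpsd ?_ (hpass j)
  rw [hΛ.tracePreserving, trace_ketbra, hst j]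

/-! ### Test states of a reliable protocol span -/

theorem isChannel_conj {V : Op} (hV : Vᴴ * V = 1) : IsChannel (krausMap fun _ : Unit => V) where
  completelyPositive k X hX := by
    have h := hX.mul_mul_conjTranspose_same ((1 : Matrix (Fin k) (Fin k) ℂ) ⊗ₖ V)
    convert h using 1
    ext ⟨p, a⟩ ⟨q, b⟩
    simp only [ampliation, krausMap, of_apply, LinearMap.coe_mk, AddHom.coe_mk,
      Finset.univ_unique, Finset.sum_singleton, mul_apply, Fintype.sum_prod_type (α₁ := Fin k),
      kroneckerMap_apply, conjTranspose_apply, one_apply]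
    rw [Finset.sum_eq_single q]
    · refine Finset.sum_congr rfl fun y _ => ?_
      rw [Finset.sum_eq_single p]
      · simp
      · intro x _ hx; simp [Ne.symm hx]
      · simp
    · intro x _ hx; simp [Ne.symm hx]
    · simp
  tracePreserving X := by
    simp only [krausMap, LinearMap.coe_mk, AddHom.coe_mk, Finset.univ_unique,
      Finset.sum_singleton]
    rw [trace_mul_comm, ← mul_assoc, hV, one_mul]

theorem krausMap_unit_apply (V X : Op) : krausMap (fun _ : Unit => V) X = V * X * Vᴴ := by
  simp [krausMap]

/-- The reflection in the hyperplane orthogonal to `n`. -/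
def reflection (n : Idx → ℂ) : Op := 1 - (2 / (star n ⬝ᵥ n)) • ketbra n

theorem reflection_mulVec (n φ : Idx → ℂ) :
    reflection n *ᵥ φ = φ - (2 / (star n ⬝ᵥ n) * (star n ⬝ᵥ φ)) • n := by
  rw [reflection, sub_mulVec, one_mulVec, smul_mulVec, ketbra_mulVec, smul_smul]

theorem reflection_conjTranspose (n : Idx → ℂ) : (reflection n)ᴴ = reflection n := by
  rw [reflection, conjTranspose_sub, conjTranspose_one, conjTranspose_smul,
    (ketbra_posSemidef n).isHermitian.eq, star_div₀, star_star_dotProduct]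
  simp

theorem reflection_mul_self {n : Idx → ℂ} (hn : n ≠ 0) : reflection n * reflection n = 1 := by
  have h0 : star n ⬝ᵥ n ≠ 0 := (dotProduct_star_self_pos_iff.mpr hn).ne'
  refine toLin'.injective (LinearMap.ext fun φ => ?_)
  simp only [toLin'_apply, ← mulVec_mulVec, one_mulVec]
  rw [reflection_mulVec, reflection_mulVec, dotProduct_sub, dotProduct_smul, sub_sub, ← add_smul,
    sub_eq_self, smul_eq_mul]
  rw [show 2 / (star n ⬝ᵥ n) * (star n ⬝ᵥ φ) + 2 / (star n ⬝ᵥ n) * (star n ⬝ᵥ φ - 2 /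
    (star n ⬝ᵥ n) * (star n ⬝ᵥ φ) * (star n ⬝ᵥ n)) = 0 by field_simp; ring, zero_smul]

theorem exists_orthogonal_ne_zero {n : Idx → ℂ} (hn : n ≠ 0) :
    ∃ m : Idx → ℂ, m ≠ 0 ∧ star n ⬝ᵥ m = 0 := by
  obtain ⟨i, hi⟩ := Function.ne_iff.mp hn
  obtain ⟨j, hj⟩ := exists_ne i
  refine ⟨star (n j) • Pi.single i 1 - star (n i) • Pi.single j 1, fun h => ?_, ?_⟩
  · have := congrFun h j
    simp [hj] at this
    exact hi this
  · simp [dotProduct_sub, mul_comm]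

/-- If some `n ≠ 0` is orthogonal to all test states, `U * reflection n` agrees with `U` on every
one of them and passes all tests, yet it is a different process. -/
theorem GateProtocol.Reliable.span_eq_top {U : Op} (hU : Uᴴ * U = 1) {P : GateProtocol U}
    (hP : P.Reliable) : Submodule.span ℂ (Set.range P.input) = ⊤ := by
  by_contra hne
  obtain ⟨f, hf0, hf⟩ := Submodule.exists_le_ker_of_lt_top _ (lt_top_iff_ne_top.mpr hne)
  let n : Idx → ℂ := fun i => star (f (Pi.single i 1))
  have hfn : ∀ φ, f φ = star n ⬝ᵥ φ := by
    intro φ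
    conv_lhs => rw [← Finset.univ_sum_single φ]
    rw [map_sum]
    refine Finset.sum_congr rfl fun i _ => ?_
    have : (Pi.single i (φ i) : Idx → ℂ) = φ i • Pi.single i 1 := by
      ext k; simp [Pi.single_apply]
    rw [this, map_smul]
    simp [n, mul_comm]
  have hn : n ≠ 0 := by
    intro h
    apply hf0
    ext φ
    simp [hfn, h]
  have hnn : star n ⬝ᵥ n ≠ 0 := (dotProduct_star_self_pos_iff.mpr hn).ne'
  have horth : ∀ j, star n ⬝ᵥ P.input j = 0 := fun j => by
    rw [← hfn]; exact hf (Submodule.subset_span ⟨j, rfl⟩)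
  have hR := reflection_mul_self hn
  have hV : (U * reflection n)ᴴ * (U * reflection n) = 1 := by
    rw [conjTranspose_mul, mul_assoc, ← mul_assoc Uᴴ, hU, one_mul, reflection_conjTranspose, hR]
  have hfixed : ∀ j, (U * reflection n) *ᵥ P.input j = U *ᵥ P.input j := fun j => by
    rw [← mulVec_mulVec, reflection_mulVec, horth]; simp
  have hpass : P.PassesWithCertainty (krausMap fun _ : Unit => U * reflection n) := fun j => by
    rw [krausMap_unit_apply, mul_ketbra_mul, hfixed, trace_mul_ketbra,
      (P.output j).verifOp_mulVec]
    exact (P.input_product j).isState.unitary hU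
  have hrel := hP _ (isChannel_conj hV) hpass
  have hket : ∀ x : Idx → ℂ, x ≠ 0 → ketbra (reflection n *ᵥ x) = ketbra x := by
    intro x hx
    have hx0 : (0 : ℂ) < star x ⬝ᵥ x := dotProduct_star_self_pos_iff.mpr hx
    have h := hrel ((star x ⬝ᵥ x)⁻¹ • ketbra x)
      ⟨(ketbra_posSemidef x).smul (inv_nonneg.mpr hx0.le), by
        rw [trace_smul, trace_ketbra, smul_eq_mul, inv_mul_cancel₀ hx0.ne']⟩
    rw [map_smul, krausMap_unit_apply, mul_ketbra_mul, mul_smul_comm, smul_mul_assoc,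
      mul_ketbra_mul, ← mulVec_mulVec] at h
    have h2 := smul_right_injective _ (inv_ne_zero hx0.ne') h
    have h3 := congrArg (fun X : Op => Uᴴ * X * Uᴴᴴ) h2
    simpa only [mul_ketbra_mul, mulVec_mulVec, ← mul_assoc, hU, one_mul, one_mulVec] using h3
  -- The state along `n + m` exposes the difference: it is reflected to `m - n`, which is not
  -- proportional to it. Applying both rank-one operators to `n` gives the contradiction.
  obtain ⟨m, hm, hnm⟩ := exists_orthogonal_ne_zero hn
  have hx : n + m ≠ 0 := by
    intro h
    apply hnn
    have := congrArg (star n ⬝ᵥ ·) h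
    simpa [dotProduct_add, hnm] using this
  have hWx : reflection n *ᵥ (n + m) = m - n := by
    rw [reflection_mulVec, dotProduct_add, hnm, add_zero, div_mul_cancel₀ _ hnn]
    module
  have h4 := congrArg (· *ᵥ n) (hket _ hx)
  have hmn : star m ⬝ᵥ n = 0 := by rw [← star_star_dotProduct, hnm, star_zero]
  simp only [hWx, ketbra_mulVec, star_sub, star_add, sub_dotProduct, add_dotProduct, hmn,
    zero_sub, add_zero] at h4
  have h5 : (2 * (star n ⬝ᵥ n)) • m = 0 := by
    rw [← sub_self ((star n ⬝ᵥ n) • (n + m))]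
    nth_rewrite 2 [← h4]
    module
  exact hm ((smul_eq_zero.mp h5).resolve_left (mul_ne_zero two_ne_zero hnn))

/-- Spanning needs four test states and each uses at least one setting. In the case of equality each
uses exactly one, and a state verified with a gap by one setting is a product. -/
theorem GateProtocol.four_le_settings {U : Op} (hU : Uᴴ * U = 1) {P : GateProtocol U}
    (hO : P.Ordinary) (hP : P.Reliable) :
    4 ≤ P.settings ∧ (P.settings = 4 → P.EntanglementFree) := by
  have h4 : 4 ≤ P.size := by
    have h := finrank_range_le_card (R := ℂ) P.input
    rw [Set.finrank, hP.span_eq_top hU, finrank_top] at h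
    simpa [Idx] using h
  have h1 : ∀ j, 1 ≤ (P.output j).size := fun j => (P.output j).size_pos
  have hsum : P.size ≤ P.settings := by
    have := Finset.sum_le_sum fun j (_ : j ∈ Finset.univ) => h1 j
    simpa [GateProtocol.settings] using this
  refine ⟨h4.trans hsum, fun hset j => ⟨P.input_product j, ?_⟩⟩
  have heq : ∑ j : Fin P.size, 1 = ∑ j, (P.output j).size := by
    have h : P.settings = ∑ j, (P.output j).size := rfl
    rw [← h]; simp; omega
  have hone := (Finset.sum_eq_sum_iff_of_le fun j _ => h1 j).mp heq j (Finset.mem_univ _)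
  exact (P.output j).isProduct_of_size_eq_one ((P.input_product j).isState.unitary hU) hone.symm
    (hO j)

/-! ### Simultaneous diagonalization -/

theorem exists_joint_eigenbasis {n : Type*} [Fintype n] [DecidableEq n] {X Y : Matrix n n ℝ}
    (hX : X.IsHermitian) (hY : Y.IsHermitian) (hXY : X * Y = Y * X) :
    ∃ (O : Matrix n n ℝ) (x y : n → ℝ), Oᵀ * O = 1 ∧ X * O = O * diagonal x ∧
      Y * O = O * diagonal y := by
  have hA := isSymmetric_toEuclideanLin_iff.mpr hX
  have hB := isSymmetric_toEuclideanLin_iff.mpr hY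
  have hAB : Commute (toEuclideanLin X) (toEuclideanLin Y) := by
    change toEuclideanLin X * toEuclideanLin Y = toEuclideanLin Y * toEuclideanLin X
    refine LinearMap.ext fun v => ?_
    simp [toEuclideanLin, toLpLin_apply, hXY]
  have hint := LinearMap.IsSymmetric.directSum_isInternal_of_commute hA hB hAB
  have horth := LinearMap.IsSymmetric.orthogonalFamily_eigenspace_inf_eigenspace hA hB
  set V : ℝ × ℝ → Submodule ℝ (EuclideanSpace ℝ n) := fun i =>
    Module.End.eigenspace (toEuclideanLin X) i.2 ⊓ Module.End.eigenspace (toEuclideanLin Y) i.1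
  -- The joint eigenspaces are indexed by all of `ℝ × ℝ`; an adapted basis requires restricting to
  -- the finitely many nonzero ones. In a pair the eigenvalue of `X` comes second.
  have hfin : Finite {i // V i ≠ ⊥} :=
    WellFoundedGT.finite_ne_bot_of_iSupIndep hint.submodule_iSupIndep
  have : Fintype {i // V i ≠ ⊥} := Fintype.ofFinite _
  have hint' := DirectSum.isInternal_ne_bot_iff.mpr hint
  have horth' := horth.comp (Subtype.val_injective (p := fun i => V i ≠ ⊥))
  have hcard : Module.finrank ℝ (EuclideanSpace ℝ n) = Fintype.card n := finrank_euclideanSpace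
  let e : Fin (Fintype.card n) ≃ n := (Fintype.equivFin n).symm
  let b := (hint'.subordinateOrthonormalBasis hcard horth').reindex e
  have hb : ∀ i, ∃ p : ℝ × ℝ, b i ∈ V p := fun i =>
    ⟨_, by
      rw [OrthonormalBasis.reindex_apply]
      exact hint'.subordinateOrthonormalBasis_subordinate hcard (e.symm i) horth'⟩
  choose p hp using hb
  refine ⟨Matrix.of fun i j => b j i, fun i => (p i).2, fun i => (p i).1, ?_, ?_, ?_⟩
  · ext i j
    have := orthonormal_iff_ite.mp b.orthonormal i j
    rw [EuclideanSpace.inner_eq_star_dotProduct, dotProduct_comm] at this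
    rw [one_apply, ← this]
    rfl
  · ext i j
    have h := Module.End.mem_eigenspace_iff.mp (hp j).1
    have h2 := congrFun (congrArg WithLp.ofLp h) i
    rw [mul_diagonal, mul_comm]
    exact h2
  · ext i j
    have h := Module.End.mem_eigenspace_iff.mp (hp j).2
    have h2 := congrFun (congrArg WithLp.ofLp h) i
    rw [mul_diagonal, mul_comm]
    exact h2

/-- A symmetric unitary matrix is diagonalized by a real orthogonal matrix. -/
theorem exists_orthogonal_diagonalization {n : Type*} [Fintype n] [DecidableEq n]
    {M : Matrix n n ℂ} (hs : Mᵀ = M) (hu : Mᴴ * M = 1) :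
    ∃ (O : Matrix n n ℂ) (Δ : n → ℂ), Oᵀ * O = 1 ∧ Oᴴ * O = 1 ∧ Oᵀ * M * O = diagonal Δ := by
  have hsym : ∀ i j, M i j = M j i := fun i j => congrFun (congrFun hs j) i
  obtain ⟨O, x, y, hO, hx, hy⟩ := exists_joint_eigenbasis (X := M.map Complex.re)
    (Y := M.map Complex.im)
    -- For symmetric `M = X + iY` with `X`, `Y` real, the imaginary part of `Mᴴ * M = 1` is `X * Y -
    -- Y * X = 0`.
    (by ext i j; simp [hsym i j]) (by ext i j; simp [hsym i j]) (by
      ext i j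
      have h := congrArg Complex.im (congrFun (congrFun hu i) j)
      simp only [mul_apply, conjTranspose_apply, Complex.im_sum, one_apply] at h
      have h0 : (if i = j then (1 : ℂ) else 0).im = 0 := by split_ifs <;> simp
      rw [h0] at h
      simp only [mul_apply, map_apply]
      rw [← sub_eq_zero, ← Finset.sum_sub_distrib, ← h]
      refine Finset.sum_congr rfl fun k _ => ?_
      rw [hsym k i]
      simp
      ring)
  have hM : M = (M.map Complex.re).map Complex.ofReal
      + Complex.I • (M.map Complex.im).map Complex.ofReal := by
    ext i j
    simp [mul_comm Complex.I]
  have hmul : ∀ A B : Matrix n n ℝ, (A * B).map Complex.ofReal =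
      A.map Complex.ofReal * B.map Complex.ofReal := fun A B => Matrix.map_mul (f := Complex.ofRealHom)
  have hO1 : (O.map Complex.ofReal)ᵀ * O.map Complex.ofReal = 1 := by
    rw [show (O.map Complex.ofReal)ᵀ = Oᵀ.map Complex.ofReal from rfl, ← hmul, hO]
    simp
  refine ⟨O.map Complex.ofReal, fun i => x i + Complex.I * y i, hO1, ?_, ?_⟩
  · rw [← hO1]
    congr 1
    ext i j
    simp
  · have hMO : M * O.map Complex.ofReal =
        O.map Complex.ofReal * diagonal fun i => x i + Complex.I * y i := by
      rw [hM, add_mul, smul_mul_assoc, ← hmul, ← hmul, hx, hy, hmul, hmul, ← mul_smul_comm,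
        ← mul_add]
      congr 1
      ext i j
      by_cases hij : i = j
      · subst hij; simp
      · simp [hij]
    rw [mul_assoc, hMO, ← mul_assoc, hO1, one_mul]

/-! ### The concurrence form and the magic basis -/

/-- The matrix `i σ_y`. -/
def flip₂ : Matrix (Fin 2) (Fin 2) ℂ := !![0, 1; -1, 0]

/-- The matrix of the concurrence form, which vanishes exactly on product vectors. -/
def flip₄ : Op := flip₂ ⊗ₖ flip₂

theorem transpose_mul_flip₂_mul (A : Matrix (Fin 2) (Fin 2) ℂ) :
    Aᵀ * flip₂ * A = A.det • flip₂ := by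
  ext i j
  fin_cases i <;> fin_cases j <;> simp [flip₂, mul_apply, det_fin_two] <;> ring

theorem transpose_mul_flip₄_mul (A B : Matrix (Fin 2) (Fin 2) ℂ) :
    (A ⊗ₖ B)ᵀ * flip₄ * (A ⊗ₖ B) = (A.det * B.det) • flip₄ := by
  rw [flip₄, show (A ⊗ₖ B)ᵀ = Aᵀ ⊗ₖ Bᵀ from (kroneckerMap_transpose _ A B).symm,
    ← mul_kronecker_mul, ← mul_kronecker_mul, transpose_mul_flip₂_mul, transpose_mul_flip₂_mul,
    smul_kronecker, kronecker_smul, smul_smul]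

theorem flip₄_form (x : Idx → ℂ) :
    x ⬝ᵥ (flip₄ *ᵥ x) = 2 * (x (0, 0) * x (1, 1) - x (0, 1) * x (1, 0)) := by
  simp [flip₄, flip₂, dotProduct, mulVec, Fintype.sum_prod_type]
  ring

/-- The form is twice the determinant of the `2 × 2` coefficient matrix, so its vanishing makes the
two columns proportional to a common unit vector. -/
theorem isProduct_of_form_eq_zero {ψ : Idx → ℂ} (hψ : IsState ψ)
    (h : ψ ⬝ᵥ (flip₄ *ᵥ ψ) = 0) : IsProduct ψ := by
  rw [flip₄_form] at h
  have hdet : ψ (0, 0) * ψ (1, 1) = ψ (0, 1) * ψ (1, 0) := by linear_combination h / 2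
  have key : ∃ (u v : Fin 2 → ℂ), IsState u ∧ ψ = tensor u v := by
    by_cases h0 : (fun i => ψ (i, 0)) = 0
    · by_cases h1 : (fun i => ψ (i, 1)) = 0
      · exact absurd (by ext ⟨i, j⟩; fin_cases j; exacts [congrFun h0 i, congrFun h1 i])
          hψ.ne_zero
      · obtain ⟨u, c, hu, hc, h2⟩ := exists_isState_smul h1
        refine ⟨u, ![0, c], hu, ?_⟩
        ext ⟨i, j⟩
        fin_cases j
        · simpa [tensor] using congrFun h0 i
        · simpa [tensor, mul_comm] using congrFun h2 i
    · obtain ⟨u, c, hu, hc, h2⟩ := exists_isState_smul h0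
      have e := expand_su2 hu (fun i => ψ (i, 1))
      refine ⟨u, ![c, star u ⬝ᵥ fun i => ψ (i, 1)], hu, ?_⟩
      have h20 := congrFun h2 0
      have h21 := congrFun h2 1
      simp only [Pi.smul_apply, smul_eq_mul] at h20 h21
      have hz : star ((su2 u).col 1) ⬝ᵥ (fun i => ψ (i, 1)) = 0 := by
        apply mul_left_cancel₀ hc
        simp [su2, dotProduct, -mul_eq_zero]
        linear_combination hdet - ψ (1, 1) * h20 + ψ (0, 1) * h21
      rw [hz, zero_smul, add_zero, su2_col_zero] at e
      ext ⟨i, j⟩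
      fin_cases j
      · simpa [tensor, mul_comm] using congrFun h2 i
      · have := congrFun e i
        simp only [Pi.smul_apply, smul_eq_mul] at this
        simpa [tensor, mul_comm] using this
  obtain ⟨u, v, hu, huv⟩ := key
  refine ⟨u, v, hu, ?_, huv⟩
  rw [IsState, huv, star_tensor_dotProduct, hu, one_mul] at hψ
  exact hψ

theorem IsProduct.form_eq_zero {ψ : Idx → ℂ} (h : IsProduct ψ) : ψ ⬝ᵥ (flip₄ *ᵥ ψ) = 0 := by
  obtain ⟨a, b, _, _, rfl⟩ := h
  rw [flip₄_form]
  simp only [tensor]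
  ring

/-- The magic basis; its columns are indexed by pairs of bits. -/
def magic : Op := Matrix.of fun x k =>
  ((Real.sqrt 2)⁻¹ : ℝ) *
    (if k = (0, 0) then (if x.1 = x.2 then 1 else 0)
    else if k = (0, 1) then (if x.1 = x.2 then 0 else Complex.I)
    else if k = (1, 0) then (if x.1 = x.2 then 0 else if x.1 = 0 then 1 else -1)
    else (if x.1 = x.2 then (if x.1 = 0 then Complex.I else -Complex.I) else 0))

theorem inv_sqrt_two_mul_self : (((Real.sqrt 2)⁻¹ : ℝ) : ℂ) * ((Real.sqrt 2)⁻¹ : ℝ) = 1 / 2 := by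
  rw [← Complex.ofReal_mul, ← mul_inv, Real.mul_self_sqrt (by norm_num)]
  norm_num

theorem magic_unitary : magicᴴ * magic = 1 := by
  have h := inv_sqrt_two_mul_self
  ext ⟨i, j⟩ ⟨k, l⟩
  simp only [magic, mul_apply, conjTranspose_apply, of_apply, Fintype.sum_prod_type,
    Fin.sum_univ_two, one_apply, star_mul', Complex.star_def, Complex.conj_ofReal]
  generalize (((Real.sqrt 2)⁻¹ : ℝ) : ℂ) = s at h
  fin_cases i <;> fin_cases j <;> fin_cases k <;> fin_cases l <;> simp <;>
    first
      | ring1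
      | linear_combination 2 * h
      | (ring_nf; simp; linear_combination 2 * h)

theorem magic_flip₄ : magicᵀ * flip₄ * magic = 1 := by
  have h := inv_sqrt_two_mul_self
  ext ⟨i, j⟩ ⟨k, l⟩
  simp only [magic, mul_apply, transpose_apply, of_apply, Fintype.sum_prod_type,
    Fin.sum_univ_two, one_apply, flip₄, flip₂, kroneckerMap_apply]
  generalize (((Real.sqrt 2)⁻¹ : ℝ) : ℂ) = s at h
  fin_cases i <;> fin_cases j <;> fin_cases k <;> fin_cases l <;> simp <;>
    first
      | ring1
      | linear_combination 2 * h
      | (ring_nf; simp; linear_combination 2 * h)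

/-- For every unitary `U` there is an orthonormal basis (the columns of `T`) in which the
concurrence of a vector and of its image under `U` are both diagonal quadratic forms. -/
theorem exists_diagonal_forms {U : Op} (hU : Uᴴ * U = 1) :
    ∃ (T : Op) (Δ : Idx → ℂ), Tᴴ * T = 1 ∧ Tᵀ * flip₄ * T = 1 ∧
      (U * T)ᵀ * flip₄ * (U * T) = diagonal Δ := by
  have hV : (U * magic)ᴴ * (U * magic) = 1 := by
    rw [conjTranspose_mul, mul_assoc, ← mul_assoc Uᴴ, hU, one_mul, magic_unitary]
  obtain ⟨V, hVdef⟩ : ∃ V, V = U * magic := ⟨_, rfl⟩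
  rw [← hVdef] at hV
  -- This is the form of the output in magic coordinates. The diagonalizing matrix is orthogonal for
  -- both the transpose and the adjoint, so it keeps the input form equal to the identity and the
  -- basis orthonormal.
  set M : Op := Vᵀ * flip₄ * V with hM
  have hfs : flip₄ᵀ = flip₄ := by
    ext ⟨i, j⟩ ⟨k, l⟩
    fin_cases i <;> fin_cases j <;> fin_cases k <;> fin_cases l <;> simp [flip₄, flip₂]
  have hfu : flip₄ᴴ * flip₄ = 1 := by
    ext ⟨i, j⟩ ⟨k, l⟩
    simp only [mul_apply, conjTranspose_apply, Fintype.sum_prod_type, Fin.sum_univ_two, one_apply,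
      flip₄, flip₂, kroneckerMap_apply]
    fin_cases i <;> fin_cases j <;> fin_cases k <;> fin_cases l <;> simp
  have hs : Mᵀ = M := by
    rw [hM, transpose_mul, transpose_mul, transpose_transpose, hfs, mul_assoc]
  have hVt : Vᵀᴴ * Vᵀ = 1 := by
    have h := congrArg transpose (mul_eq_one_comm.mp hV)
    rwa [transpose_mul, transpose_one] at h
  have hu : Mᴴ * M = 1 := by
    rw [hM, conjTranspose_mul, conjTranspose_mul]
    calc Vᴴ * (flip₄ᴴ * Vᵀᴴ) * (Vᵀ * flip₄ * V)
        = Vᴴ * (flip₄ᴴ * (Vᵀᴴ * Vᵀ) * flip₄) * V := by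
          simp only [mul_assoc]
      _ = 1 := by rw [hVt, mul_one, hfu, mul_one, hV]
  obtain ⟨O, Δ, hO, hO', hd⟩ := exists_orthogonal_diagonalization hs hu
  refine ⟨magic * O, Δ, ?_, ?_, ?_⟩
  · rw [conjTranspose_mul, mul_assoc, ← mul_assoc magicᴴ, magic_unitary, one_mul, hO']
  · rw [transpose_mul]
    calc Oᵀ * magicᵀ * flip₄ * (magic * O) = Oᵀ * (magicᵀ * flip₄ * magic) * O := by
          simp only [mul_assoc]
      _ = 1 := by rw [magic_flip₄, mul_one, hO]
  · rw [← hd, hM, ← mul_assoc U, ← hVdef, transpose_mul V]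
    simp only [mul_assoc]

/-! ### Test states from isotropic vectors -/

/-- `T` diagonalizes the concurrence of a vector (to the identity) and of its image under `U`
(to `Δ`). -/
structure DiagonalForms (U T : Op) (Δ : Idx → ℂ) : Prop where
  unitary : Tᴴ * T = 1
  input : Tᵀ * flip₄ * T = 1
  output : (U * T)ᵀ * flip₄ * (U * T) = diagonal Δ

namespace DiagonalForms

variable {U T : Op} {Δ : Idx → ℂ}

theorem input_form (h : DiagonalForms U T Δ) (w : Idx → ℂ) :
    (T *ᵥ w) ⬝ᵥ (flip₄ *ᵥ (T *ᵥ w)) = ∑ i, w i ^ 2 := by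
  rw [← vecMul_transpose T w, ← dotProduct_mulVec, vecMul_transpose, mulVec_mulVec, mulVec_mulVec,
    h.input, one_mulVec]
  simp [dotProduct, sq]

theorem output_form (h : DiagonalForms U T Δ) (w : Idx → ℂ) :
    (U *ᵥ (T *ᵥ w)) ⬝ᵥ (flip₄ *ᵥ (U *ᵥ (T *ᵥ w))) = ∑ i, Δ i * w i ^ 2 := by
  rw [mulVec_mulVec, ← vecMul_transpose (U * T) w, ← dotProduct_mulVec, vecMul_transpose,
    mulVec_mulVec, mulVec_mulVec, h.output]
  simp only [dotProduct, mulVec_diagonal]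
  exact Finset.sum_congr rfl fun i _ => by ring

/-- Four isotropic vectors which form a basis and all overlap with one of them provide a protocol;
`N j` settings are used for the `j`-th test state. -/
theorem exists_protocol (h : DiagonalForms U T Δ) (hU : Uᴴ * U = 1) {φ : Fin 4 → Idx → ℂ}
    (hiso : ∀ j, ∑ i, φ j i ^ 2 = 0) (hspan : Submodule.span ℂ (Set.range φ) = ⊤) (j₀ : Fin 4)
    (hov : ∀ j, star (φ j₀) ⬝ᵥ φ j ≠ 0) (N : Fin 4 → ℕ)
    (hN : ∀ j, N j = 2 ∨ (N j = 1 ∧ ∑ i, Δ i * φ j i ^ 2 = 0)) :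
    ∃ P : GateProtocol U, P.Ordinary ∧ P.Reliable ∧ P.settings = ∑ j, N j ∧
      ((∀ j, ∑ i, Δ i * φ j i ^ 2 = 0) → P.EntanglementFree) := by
  have hne : ∀ j, φ j ≠ 0 := fun j hj => hov j (by simp [hj])
  choose χ c hχ hc hφ using fun j => exists_isState_smul (hne j)
  have hscale : ∀ (j : Fin 4) (f : Idx → ℂ), ∑ i, f i * φ j i ^ 2 = c j ^ 2 * ∑ i, f i * χ j i ^ 2 := by
    intro j f
    rw [Finset.mul_sum]
    refine Finset.sum_congr rfl fun i _ => ?_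
    rw [hφ j, Pi.smul_apply, smul_eq_mul]
    ring
  have hzero : ∀ (j : Fin 4) (f : Idx → ℂ), ∑ i, f i * φ j i ^ 2 = 0 → ∑ i, f i * χ j i ^ 2 = 0 := by
    intro j f hf
    rw [hscale] at hf
    exact (mul_eq_zero.mp hf).resolve_left (pow_ne_zero 2 (hc j))
  have hst : ∀ j, IsState (T *ᵥ χ j) := fun j => (hχ j).unitary h.unitary
  have hprod : ∀ j, IsProduct (T *ᵥ χ j) := fun j => by
    refine isProduct_of_form_eq_zero (hst j) ?_
    rw [h.input_form]
    have := hzero j 1 (by simpa using hiso j)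
    simpa using this
  have hout : ∀ j, ∑ i, Δ i * φ j i ^ 2 = 0 → IsProduct (U *ᵥ (T *ᵥ χ j)) := fun j hj => by
    refine isProduct_of_form_eq_zero ((hst j).unitary hU) ?_
    rw [h.output_form]
    exact hzero j Δ hj
  have hspanχ : Submodule.span ℂ (Set.range χ) = ⊤ := by
    rw [eq_top_iff, ← hspan, Submodule.span_le]
    rintro _ ⟨j, rfl⟩
    rw [hφ j]
    exact Submodule.smul_mem _ _ (Submodule.subset_span ⟨j, rfl⟩)
  have hspan' : Submodule.span ℂ (Set.range fun j => T *ᵥ χ j) = ⊤ := by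
    have h1 : (Set.range fun j => T *ᵥ χ j) = T.mulVecLin '' Set.range χ := by
      rw [← Set.range_comp]; rfl
    rw [h1, ← Submodule.map_span, hspanχ, Submodule.map_top, LinearMap.range_eq_top]
    intro x
    exact ⟨Tᴴ *ᵥ x, by rw [mulVecLin_apply, mulVec_mulVec, mul_eq_one_comm.mp h.unitary, one_mulVec]⟩
  have hov' : ∀ j, star (T *ᵥ χ j₀) ⬝ᵥ (T *ᵥ χ j) ≠ 0 := by
    intro j h0
    apply hov j
    rw [inner_unitary h.unitary] at h0
    rw [hφ j₀, hφ j, star_smul, smul_dotProduct, dotProduct_smul, h0]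
    simp
  have hS : ∀ j, ∃ S : StateProtocol (U *ᵥ (T *ᵥ χ j)), S.size = N j ∧ 0 < S.spectralGap := by
    intro j
    rcases hN j with h2 | ⟨h1, h0⟩
    · rw [h2]; exact exists_protocol_of_isState ((hst j).unitary hU)
    · rw [h1]; exact exists_protocol_of_isProduct (hout j h0)
  choose S hsize hgap using hS
  obtain ⟨P, hO, hR, hset, hEF⟩ := exists_gateProtocol hU hprod hspan' j₀ hov' S hgap
  exact ⟨P, hO, hR, by rw [hset]; simp only [hsize], fun h0 => hEF fun j => hout j (h0 j)⟩

end DiagonalForms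

/-- All but one of the entries agree. -/
def IsSpecial {n α : Type*} (Δ : n → α) : Prop := ∃ k c, Δ k ≠ c ∧ ∀ j, j ≠ k → Δ j = c

/-- The coordinate `v i` vanishes on all solutions only if it is a combination of the forms with
coefficients `1` and `Δ`, which forces `Δ` to be constant off `i` with another value at `i`. -/
theorem exists_kernel_apply_ne_zero {Δ : Idx → ℂ} (hΔ : ¬ IsSpecial Δ) (i : Idx) :
    ∃ v : Idx → ℂ, ∑ j, v j = 0 ∧ ∑ j, Δ j * v j = 0 ∧ v i ≠ 0 := by
  by_cases hall : ∀ a b, a ≠ i → b ≠ i → Δ a = Δ b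
  · obtain ⟨a, ha⟩ := exists_ne i
    have hia : Δ i = Δ a := by
      by_contra hne
      exact hΔ ⟨i, Δ a, hne, fun j hj => hall j a hj ha⟩
    refine ⟨Pi.single i 1 - Pi.single a 1, by simp [Finset.sum_sub_distrib], ?_, by simp [ha.symm]⟩
    simp [mul_sub, Finset.sum_sub_distrib, Pi.single_apply, hia]
  · push Not at hall
    obtain ⟨a, b, ha, hb, hab⟩ := hall
    have hd : Δ a - Δ b ≠ 0 := sub_ne_zero.mpr hab
    -- Cramer's rule for the entries at `a` and `b`, with the entry at `i` set to `1`.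
    refine ⟨Pi.single i 1 + ((Δ b - Δ i) / (Δ a - Δ b)) • Pi.single a 1
      + ((Δ i - Δ a) / (Δ a - Δ b)) • Pi.single b 1, ?_, ?_, ?_⟩
    · simp only [Pi.add_apply, Pi.smul_apply, Finset.sum_add_distrib, smul_eq_mul, Pi.single_apply,
        mul_ite, mul_one, mul_zero, Finset.sum_ite_eq', Finset.mem_univ, if_true]
      field_simp
      ring
    · simp only [Pi.add_apply, Pi.smul_apply, Finset.sum_add_distrib, smul_eq_mul, Pi.single_apply,
        mul_ite, mul_one, mul_zero, Finset.sum_ite_eq', Finset.mem_univ, if_true, mul_add]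
      field_simp
      ring
    · simp [ha.symm, hb.symm]

/-- Each coordinate hyperplane meets the solution space in a proper subspace, and a complex vector
space is not a finite union of proper subspaces. -/
theorem exists_kernel_forall_ne_zero {Δ : Idx → ℂ} (hΔ : ¬ IsSpecial Δ) :
    ∃ v : Idx → ℂ, ∑ j, v j = 0 ∧ ∑ j, Δ j * v j = 0 ∧ ∀ i, v i ≠ 0 := by
  let K : Submodule ℂ (Idx → ℂ) :=
    { carrier := {v | ∑ j, v j = 0 ∧ ∑ j, Δ j * v j = 0}
      add_mem' := fun {v w} hv hw => by
        simp [mul_add, Finset.sum_add_distrib, hv.1, hv.2, hw.1, hw.2]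
      zero_mem' := by simp
      smul_mem' := fun c v hv => by
        refine ⟨?_, ?_⟩
        · simp [← Finset.mul_sum, hv.1]
        · simp [mul_left_comm _ c, ← Finset.mul_sum, hv.2] }
  let p : Idx → Submodule ℂ K := fun i => LinearMap.ker ((LinearMap.proj i).comp K.subtype)
  have hp : ⊤ ∉ Finset.univ.image p := by
    intro htop
    obtain ⟨i, _, hi⟩ := Finset.mem_image.mp htop
    obtain ⟨v, h1, h2, h3⟩ := exists_kernel_apply_ne_zero hΔ i
    have hv : (⟨v, h1, h2⟩ : K) ∈ p i := by rw [hi]; trivial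
    exact h3 hv
  have hcov := Subspace.biUnion_ne_univ_of_top_notMem hp
  obtain ⟨v, hv⟩ := (Set.ne_univ_iff_exists_notMem _).mp hcov
  refine ⟨v, v.2.1, v.2.2, fun i hi => hv ?_⟩
  simp only [Set.mem_iUnion]
  exact ⟨p i, Finset.mem_image_of_mem p (Finset.mem_univ i), hi⟩

/-- The vector `w` with the sign of its `i`-th entry flipped, for `i ≠ i₀`; for `i = i₀` it is `w`
itself. -/
def signFlip (w : Idx → ℂ) (i₀ i : Idx) : Idx → ℂ :=
  if i = i₀ then w else w - (2 * w i) • Pi.single i 1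

theorem signFlip_sq (w : Idx → ℂ) (i₀ i j : Idx) : signFlip w i₀ i j ^ 2 = w j ^ 2 := by
  unfold signFlip
  split_ifs with h
  · rfl
  · by_cases hj : j = i
    · subst hj; simp; ring
    · simp [hj]

/-- The difference of `w` and its flip at `i ≠ i₀` is `2 * w i` times a basis vector; `w` itself
then supplies the one at `i₀`. -/
theorem span_signFlip {w : Idx → ℂ} (hw : ∀ i, w i ≠ 0) (i₀ : Idx) :
    Submodule.span ℂ (Set.range (signFlip w i₀)) = ⊤ := by
  set W := Submodule.span ℂ (Set.range (signFlip w i₀)) with hW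
  have hmem : ∀ i, signFlip w i₀ i ∈ W := fun i => Submodule.subset_span ⟨i, rfl⟩
  have hw0 : w ∈ W := by simpa [signFlip] using hmem i₀
  have hne : ∀ i, i ≠ i₀ → (Pi.single i 1 : Idx → ℂ) ∈ W := by
    intro i hi
    have h1 := W.sub_mem hw0 (hmem i)
    rw [signFlip, if_neg hi, sub_sub_cancel] at h1
    exact (W.smul_mem_iff (mul_ne_zero two_ne_zero (hw i))).mp h1
  have hall : ∀ i, (Pi.single i 1 : Idx → ℂ) ∈ W := by
    intro i
    by_cases hi : i = i₀
    · subst hi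
      have h1 : w i • (Pi.single i 1 : Idx → ℂ) = w - ∑ j ∈ Finset.univ.erase i, w j • Pi.single j 1 := by
        rw [eq_sub_iff_add_eq, Finset.add_sum_erase _ (fun j => w j • (Pi.single j 1 : Idx → ℂ))
          (Finset.mem_univ i)]
        exact (pi_eq_sum_univ' w).symm
      have h2 : w i • (Pi.single i 1 : Idx → ℂ) ∈ W := by
        rw [h1]
        exact W.sub_mem hw0 (W.sum_mem fun j hj => W.smul_mem _ (hne j (Finset.ne_of_mem_erase hj)))
      exact (W.smul_mem_iff (hw i)).mp h2
    · exact hne i hi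
  rw [eq_top_iff]
  intro x _
  rw [pi_eq_sum_univ' x]
  exact W.sum_mem fun j _ => W.smul_mem _ (hall j)

/-- The overlap of `w` with its flip at `i` is `‖w‖² - 2 |w i|²`. It vanishes for at most one index,
since two such entries would exhaust the norm; that index is taken as `i₀`, where nothing is
flipped. -/
theorem exists_signFlip_overlap {w : Idx → ℂ} (hw : ∀ i, w i ≠ 0) :
    ∃ i₀, ∀ i, star w ⬝ᵥ signFlip w i₀ i ≠ 0 := by
  have hpos : ∀ i, 0 < Complex.normSq (w i) := fun i => Complex.normSq_pos.mpr (hw i)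
  have hself : star w ⬝ᵥ w = ((∑ i, Complex.normSq (w i) : ℝ) : ℂ) := by
    simp only [dotProduct, Pi.star_apply, Complex.ofReal_sum, Complex.normSq_eq_conj_mul_self]
    rfl
  have hflip : ∀ i₀ i, i ≠ i₀ → star w ⬝ᵥ signFlip w i₀ i =
      ((∑ j, Complex.normSq (w j) - 2 * Complex.normSq (w i) : ℝ) : ℂ) := by
    intro i₀ i hi
    rw [signFlip, if_neg hi, dotProduct_sub, hself, dotProduct_smul]
    simp only [Complex.ofReal_sub, Complex.ofReal_mul, Complex.normSq_eq_conj_mul_self]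
    simp
    ring
  have hcase : ∃ i₀, ∀ i, i ≠ i₀ → ∑ j, Complex.normSq (w j) - 2 * Complex.normSq (w i) ≠ 0 := by
    by_cases hex : ∃ i₀, ∑ j, Complex.normSq (w j) - 2 * Complex.normSq (w i₀) = 0
    · obtain ⟨i₀, h0⟩ := hex
      refine ⟨i₀, fun i hi h1 => ?_⟩
      obtain ⟨k, hk0, hki⟩ : ∃ k : Idx, k ≠ i₀ ∧ k ≠ i := by
        have hd : ∀ a b : Idx, ∃ k, k ≠ a ∧ k ≠ b := by decide
        exact hd i₀ i
      have hsum : Complex.normSq (w i₀) + (Complex.normSq (w i) + Complex.normSq (w k))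
          ≤ ∑ j, Complex.normSq (w j) := by
        rw [← Finset.sum_pair (f := fun j => Complex.normSq (w j)) hki.symm, ← Finset.sum_insert
          (f := fun j => Complex.normSq (w j)) (by simp [hi.symm, hk0.symm])]
        exact Finset.sum_le_sum_of_subset_of_nonneg (Finset.subset_univ _)
          fun j _ _ => (hpos j).le
      have := hpos k
      linarith
    · push Not at hex
      exact ⟨(0, 0), fun i _ => hex i⟩
  obtain ⟨i₀, h⟩ := hcase
  refine ⟨i₀, fun i => ?_⟩
  by_cases hi : i = i₀
  · rw [signFlip, if_pos hi, hself]
    have : 0 < ∑ i, Complex.normSq (w i) := Finset.sum_pos (fun i _ => hpos i) ⟨(0, 0), by simp⟩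
    exact_mod_cast this.ne'
  · rw [hflip i₀ i hi]
    exact_mod_cast h i hi

namespace DiagonalForms

variable {U T : Op} {Δ : Idx → ℂ}

/-- Both product conditions involve only the squares `w i ^ 2 = v i`, so they survive sign changes.
-/
theorem exists_protocol_of_not_isSpecial (h : DiagonalForms U T Δ) (hU : Uᴴ * U = 1)
    (hΔ : ¬ IsSpecial Δ) :
    ∃ P : GateProtocol U, P.Ordinary ∧ P.Reliable ∧ P.settings = 4 ∧ P.EntanglementFree := by
  obtain ⟨v, hv1, hv2, hv⟩ := exists_kernel_forall_ne_zero hΔ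
  choose w hw using fun i => IsAlgClosed.exists_pow_nat_eq (v i) (n := 2) (by norm_num)
  have hw0 : ∀ i, w i ≠ 0 := fun i hi => hv i (by rw [← hw i, hi]; simp)
  obtain ⟨i₀, hov⟩ := exists_signFlip_overlap hw0
  let e : Fin 4 ≃ Idx := (Fintype.equivFinOfCardEq (by simp [Idx])).symm
  have hout : ∀ j, ∑ i, Δ i * signFlip w i₀ (e j) i ^ 2 = 0 := fun j => by
    simpa only [signFlip_sq, hw] using hv2
  obtain ⟨P, hO, hR, hset, hEF⟩ := h.exists_protocol hU (φ := fun j => signFlip w i₀ (e j))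
    (fun j => by simpa only [signFlip_sq, hw] using hv1)
    (by
      rw [show (fun j => signFlip w i₀ (e j)) = signFlip w i₀ ∘ e from rfl,
        e.surjective.range_comp]
      exact span_signFlip hw0 i₀)
    (e.symm i₀)
    (fun j => by
      have : signFlip w i₀ (e (e.symm i₀)) = w := by simp [signFlip]
      rw [this]
      exact hov (e j))
    (fun _ => 1) (fun j => Or.inr ⟨rfl, hout j⟩)
  exact ⟨P, hO, hR, by simpa using hset, hEF hout⟩

theorem exists_protocol_five (h : DiagonalForms U T Δ) (hU : Uᴴ * U = 1) (hΔ : IsSpecial Δ) :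
    ∃ P : GateProtocol U, P.Ordinary ∧ P.Reliable ∧ P.settings = 5 := by
  obtain ⟨k, c, -, hc⟩ := hΔ
  let e₀ : Fin 4 ≃ Idx := (Fintype.equivFinOfCardEq (by simp [Idx])).symm
  let e : Fin 4 ≃ Idx := (Equiv.swap 3 (e₀.symm k)).trans e₀
  have he3 : e 3 = k := by simp [e]
  have hec : ∀ j : Fin 4, j ≠ 3 → Δ (e j) = c := fun j hj =>
    hc _ fun h => hj (e.injective (h.trans he3.symm))
  -- Coordinates are ordered so that the exceptional index `k` is last. The first three rows are
  -- isotropic by `3² + 4² = 5²` and vanish at `k`, so their outputs are products too; the last row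
  -- reaches `k` at the cost of two settings. The overlaps with the first row are `50`, `32`, `18`
  -- and `3`.
  let A : Matrix (Fin 4) (Fin 4) ℂ :=
    !![3, 4, 5 * Complex.I, 0; -3, 4, 5 * Complex.I, 0; 3, -4, 5 * Complex.I, 0;
      1, 0, 0, Complex.I]
  let φ : Fin 4 → Idx → ℂ := fun j i => A j (e.symm i)
  have hsum : ∀ f : Idx → ℂ, ∑ i, f i = f (e 0) + f (e 1) + f (e 2) + f (e 3) := fun f => by
    rw [← e.sum_comp, Fin.sum_univ_four]
  have hA : ∀ j i, φ j (e i) = A j i := fun j i => by simp [φ]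
  have hI : Complex.I ^ 2 = -1 := Complex.I_sq
  obtain ⟨P, hO, hR, hset, -⟩ := h.exists_protocol hU (φ := φ)
    (fun j => by
      rw [hsum]
      simp only [hA]
      fin_cases j <;> simp [A, mul_pow] <;> norm_num)
    (by
      have hli : LinearIndependent ℂ φ := by
        rw [Fintype.linearIndependent_iff]
        intro g hg
        have hg' : ∀ i, g 0 * A 0 i + g 1 * A 1 i + g 2 * A 2 i + g 3 * A 3 i = 0 := by
          intro i
          have := congrFun hg (e i)
          simpa [Fin.sum_univ_four, hA] using this
        have h0 := hg' 0
        have h1 := hg' 1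
        have h2 := hg' 2
        have h3 := hg' 3
        simp [A] at h0 h1 h2 h3
        rw [h3] at h0
        have h2' : g 0 + g 1 + g 2 = 0 := by
          have : (5 * Complex.I) * (g 0 + g 1 + g 2) = 0 := by linear_combination h2
          exact (mul_eq_zero.mp this).resolve_left (by simp)
        have g1 : g 1 = 0 := by linear_combination (1 / 2 : ℂ) * h2' - (1 / 6 : ℂ) * h0
        have g2 : g 2 = 0 := by linear_combination (1 / 2 : ℂ) * h2' - (1 / 8 : ℂ) * h1
        have g0 : g 0 = 0 := by linear_combination h2' - g1 - g2
        intro i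
        fin_cases i
        exacts [g0, g1, g2, h3]
      exact hli.span_eq_top_of_card_eq_finrank' (by simp [Idx]))
    0
    (fun j => by
      rw [dotProduct, hsum]
      simp only [Pi.star_apply, hA]
      fin_cases j <;> simp [A] <;> ring_nf <;> simp <;> norm_num)
    ![1, 1, 1, 2]
    (fun j => by
      rw [hsum]
      simp only [hA]
      rw [hec 0 (by decide), hec 1 (by decide), hec 2 (by decide)]
      fin_cases j
      · exact Or.inr ⟨rfl, by simp [A]; ring_nf; simp⟩
      · exact Or.inr ⟨rfl, by simp [A]; ring_nf; simp⟩
      · exact Or.inr ⟨rfl, by simp [A]; ring_nf; simp⟩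
      · exact Or.inl rfl)
  exact ⟨P, hO, hR, by rw [hset]; rfl⟩

/-- Subtracting `c` times the input equation from the output equation leaves `(Δ k - c) * w k ^ 2 =
0`, so all test states lie in one hyperplane. -/
theorem not_entanglementFree (h : DiagonalForms U T Δ) (hU : Uᴴ * U = 1) (hΔ : IsSpecial Δ)
    {P : GateProtocol U} (hR : P.Reliable) : ¬ P.EntanglementFree := by
  intro hEF
  obtain ⟨k, c, hk, hc⟩ := hΔ
  have hzero : ∀ j, (Tᴴ *ᵥ P.input j) k = 0 := by
    intro j
    set w := Tᴴ *ᵥ P.input j with hw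
    have hTw : T *ᵥ w = P.input j := by
      rw [hw, mulVec_mulVec, mul_eq_one_comm.mp h.unitary, one_mulVec]
    have h1 := (hEF j).1.form_eq_zero
    have h2 := (hEF j).2.form_eq_zero
    rw [← hTw, h.input_form] at h1
    rw [← hTw, h.output_form] at h2
    have h3 : ∑ i, (Δ i - c) * w i ^ 2 = 0 := by
      simp only [sub_mul, Finset.sum_sub_distrib, ← Finset.mul_sum, h1, h2]
      simp
    rw [Finset.sum_eq_single k (fun i _ hi => by rw [hc i hi, sub_self, zero_mul]) (by simp)] at h3
    exact pow_eq_zero_iff (two_ne_zero) |>.mp ((mul_eq_zero.mp h3).resolve_left (sub_ne_zero.mpr hk))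
  let f : (Idx → ℂ) →ₗ[ℂ] ℂ := (LinearMap.proj k).comp Tᴴ.mulVecLin
  have hle : Submodule.span ℂ (Set.range P.input) ≤ LinearMap.ker f := by
    rw [Submodule.span_le]
    rintro _ ⟨j, rfl⟩
    exact hzero j
  rw [hR.span_eq_top hU] at hle
  have hmem : T *ᵥ Pi.single k 1 ∈ LinearMap.ker f := hle trivial
  rw [LinearMap.mem_ker] at hmem
  have : f (T *ᵥ Pi.single k 1) = 1 := by
    simp only [f, LinearMap.comp_apply, mulVecLin_apply, mulVec_mulVec, h.unitary, one_mulVec,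
      LinearMap.proj_apply, Pi.single_eq_same]
  rw [this] at hmem
  exact one_ne_zero hmem

end DiagonalForms

/-! ### Local unitaries and the magic basis -/

theorem kronecker_unitary {A B : Matrix (Fin 2) (Fin 2) ℂ} (hA : Aᴴ * A = 1) (hB : Bᴴ * B = 1) :
    (A ⊗ₖ B)ᴴ * (A ⊗ₖ B) = (1 : Op) := by
  rw [conjTranspose_kronecker, ← mul_kronecker_mul, hA, hB, one_kronecker_one]

theorem unitary_mul {n : Type*} [Fintype n] [DecidableEq n] {A B : Matrix n n ℂ}
    (hA : Aᴴ * A = 1) (hB : Bᴴ * B = 1) : (A * B)ᴴ * (A * B) = 1 := by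
  rw [conjTranspose_mul, mul_assoc, ← mul_assoc Aᴴ, hA, one_mul, hB]

theorem su2_det {a : Fin 2 → ℂ} (ha : IsState a) : (su2 a).det = 1 := by
  rw [isState_fin_two] at ha
  simp [su2, det_fin_two] at ha ⊢
  linear_combination ha

/-- The columns of a matrix preserving the concurrence form and fixing `|00⟩`. -/
theorem entries_of_fix {V : Op} (hu : Vᴴ * V = 1) (hf : Vᵀ * flip₄ * V = flip₄)
    (h0 : ∀ x, V x (0, 0) = if x = (0, 0) then 1 else 0) :
    ∃ p q r t : ℂ, ((q = 0 ∧ r = 0 ∧ p * t = 1 ∧ star p * p = 1 ∧ star t * t = 1) ∨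
      (p = 0 ∧ t = 0 ∧ q * r = 1 ∧ star q * q = 1 ∧ star r * r = 1)) ∧
      V = Matrix.of fun x y =>
        if x = (0, 0) then (if y = (0, 0) then 1 else 0)
        else if x = (1, 1) then (if y = (1, 1) then 1 else 0)
        else if x = (0, 1) then (if y = (0, 1) then p else if y = (1, 0) then q else 0)
        else (if y = (0, 1) then r else if y = (1, 0) then t else 0) := by
  have hu' : V * Vᴴ = 1 := mul_eq_one_comm.mp hu
  have c00 := h0 (0, 0)
  have c01 := h0 (0, 1)
  have c10 := h0 (1, 0)
  have c11 := h0 (1, 1)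
  simp at c00 c01 c10 c11
  have form : ∀ i j, V (0, 0) i * V (1, 1) j + V (1, 1) i * V (0, 0) j - V (0, 1) i * V (1, 0) j
      - V (1, 0) i * V (0, 1) j = flip₄ i j := by
    intro i j
    rw [← congrFun (congrFun hf i) j]
    simp [mul_apply, Fintype.sum_prod_type, flip₄, flip₂]
    ring
  have ortho : ∀ j, V (0, 0) j = (1 : Op) (0, 0) j := by
    intro j
    rw [← congrFun (congrFun hu (0, 0)) j]
    simp [mul_apply, Fintype.sum_prod_type, c00, c01, c10, c11]
  have row00 : ∀ j, V (0, 0) j = if j = (0, 0) then 1 else 0 := by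
    intro j
    rw [ortho, one_apply]
    simp [eq_comm]
  -- Since the first column is `|00⟩`, the bilinear form of the first column with column `j` is the
  -- entry `V (1, 1) j`.
  have row11 : ∀ j, V (1, 1) j = if j = (1, 1) then 1 else 0 := by
    intro j
    have := form (0, 0) j
    rw [c00, c01, c10, c11] at this
    simp at this
    rw [this]
    obtain ⟨a, b⟩ := j
    fin_cases a <;> fin_cases b <;> simp [flip₄, flip₂]
  have r1 : ∀ x, x ≠ (1, 1) → V x (1, 1) = 0 := by
    intro x hx
    have := congrFun (congrFun hu' x) (1, 1)
    rw [mul_apply, one_apply_ne hx] at this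
    simpa [row11] using this
  have f1 := form (0, 1) (0, 1)
  have f2 := form (1, 0) (1, 0)
  have f3 := form (0, 1) (1, 0)
  have n1 := congrFun (congrFun hu (0, 1)) (0, 1)
  have n2 := congrFun (congrFun hu (1, 0)) (1, 0)
  simp [mul_apply, Fintype.sum_prod_type, row00, row11] at n1 n2
  simp [flip₄, flip₂, row00, row11] at f1 f2 f3
  refine ⟨V (0, 1) (0, 1), V (0, 1) (1, 0), V (1, 0) (0, 1), V (1, 0) (1, 0), ?_, ?_⟩
  · have hpr : V (0, 1) (0, 1) * V (1, 0) (0, 1) = 0 := by linear_combination (-1 / 2 : ℂ) * f1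
    have hqt : V (0, 1) (1, 0) * V (1, 0) (1, 0) = 0 := by linear_combination (-1 / 2 : ℂ) * f2
    have hdet : V (0, 1) (0, 1) * V (1, 0) (1, 0) + V (1, 0) (0, 1) * V (0, 1) (1, 0) = 1 := by
      linear_combination -f3
    rcases mul_eq_zero.mp hpr with h | h
    · right
      rw [h, zero_mul, zero_add] at hdet
      have hq : V (0, 1) (1, 0) ≠ 0 := by intro h'; rw [h', mul_zero] at hdet; exact zero_ne_one hdet
      have ht := (mul_eq_zero.mp hqt).resolve_left hq
      refine ⟨h, ht, by rw [mul_comm]; exact hdet, ?_, ?_⟩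
      · simpa [ht] using n2
      · simpa [h] using n1
    · left
      rw [h, zero_mul, add_zero] at hdet
      have ht : V (1, 0) (1, 0) ≠ 0 := by intro h'; rw [h', mul_zero] at hdet; exact zero_ne_one hdet
      have hq := (mul_eq_zero.mp hqt).resolve_right ht
      refine ⟨hq, h, hdet, ?_, ?_⟩
      · simpa [h] using n1
      · simpa [hq] using n2
  · have r01 := r1 (0, 1) (by decide)
    have r10 := r1 (1, 0) (by decide)
    ext ⟨a, b⟩ ⟨c, d⟩
    fin_cases a <;> fin_cases b <;> fin_cases c <;> fin_cases d <;>
      simp [row00, row11, c01, c10, r01, r10]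

theorem phase_unitary {p : ℂ} (hp : star p * p = 1) :
    (diagonal ![1, p])ᴴ * diagonal ![1, p] = 1 := by
  simp at hp
  ext i j
  fin_cases i <;> fin_cases j <;> simp [hp]

/-- An orthonormal basis that diagonalizes the concurrence form is the image of the magic basis
under a local unitary, up to signs. -/
theorem eq_kronecker_mul_magic {T : Op} (hu : Tᴴ * T = 1) (hf : Tᵀ * flip₄ * T = 1) :
    ∃ (A B : Matrix (Fin 2) (Fin 2) ℂ) (η : Idx → ℂ), Aᴴ * A = 1 ∧ Bᴴ * B = 1 ∧
      (∀ i, η i = 1 ∨ η i = -1) ∧ T = (A ⊗ₖ B) * magic * diagonal η := by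
  have hm' : magic * magicᴴ = 1 := mul_eq_one_comm.mp magic_unitary
  have hflip : magicᴴᵀ * magicᴴ = flip₄ := by
    have h1 : magicᴴᵀ * magicᵀ = 1 := by rw [← transpose_mul, hm', transpose_one]
    calc magicᴴᵀ * magicᴴ = magicᴴᵀ * (magicᵀ * flip₄ * magic) * magicᴴ := by
          rw [magic_flip₄, mul_one]
      _ = (magicᴴᵀ * magicᵀ) * flip₄ * (magic * magicᴴ) := by simp only [mul_assoc]
      _ = flip₄ := by rw [h1, hm', one_mul, mul_one]
  -- `V` preserves the concurrence form, hence maps `|00⟩` to a product vector; undoing this by a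
  -- local special unitary `L` leaves a `W` that fixes `|00⟩`.
  set V := T * magicᴴ with hV
  have hVu : Vᴴ * V = 1 := unitary_mul hu (by rw [conjTranspose_conjTranspose, hm'])
  have hVf : Vᵀ * flip₄ * V = flip₄ := by
    rw [hV, transpose_mul]
    calc magicᴴᵀ * Tᵀ * flip₄ * (T * magicᴴ) = magicᴴᵀ * (Tᵀ * flip₄ * T) * magicᴴ := by
          simp only [mul_assoc]
      _ = flip₄ := by rw [hf, mul_one, hflip]
  have hTV : T = V * magic := by rw [hV, mul_assoc, magic_unitary, mul_one]
  have he : tensor ![1, 0] ![1, 0] = Pi.single ((0, 0) : Idx) (1 : ℂ) := by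
    ext ⟨i, j⟩; fin_cases i <;> fin_cases j <;> simp [tensor]
  have hprod : IsProduct (V *ᵥ Pi.single (0, 0) 1) := by
    refine isProduct_of_form_eq_zero (IsState.unitary hVu ?_) ?_
    · simp [IsState]
    · rw [← vecMul_transpose V, ← dotProduct_mulVec, vecMul_transpose, mulVec_mulVec,
        mulVec_mulVec, hVf, flip₄_form]
      simp
  obtain ⟨a, b, ha, hb, hab⟩ := hprod
  set L : Op := su2 a ⊗ₖ su2 b with hL
  have hLu : Lᴴ * L = 1 := kronecker_unitary (su2_unitary ha) (su2_unitary hb)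
  have hLu' : L * Lᴴ = 1 := mul_eq_one_comm.mp hLu
  have hLf : Lᵀ * flip₄ * L = flip₄ := by
    rw [hL, transpose_mul_flip₄_mul, su2_det ha, su2_det hb, one_mul, one_smul]
  have hLf' : Lᴴᵀ * flip₄ * Lᴴ = flip₄ := by
    have h1 : Lᴴᵀ * Lᵀ = 1 := by rw [← transpose_mul, hLu', transpose_one]
    calc Lᴴᵀ * flip₄ * Lᴴ = Lᴴᵀ * (Lᵀ * flip₄ * L) * Lᴴ := by rw [hLf]
      _ = (Lᴴᵀ * Lᵀ) * flip₄ * (L * Lᴴ) := by simp only [mul_assoc]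
      _ = flip₄ := by rw [h1, hLu', one_mul, mul_one]
  have hVL : V = L * (Lᴴ * V) := by rw [← mul_assoc, hLu', one_mul]
  set W := Lᴴ * V with hW
  have hWu : Wᴴ * W = 1 := unitary_mul (by rw [conjTranspose_conjTranspose, hLu']) hVu
  have hWf : Wᵀ * flip₄ * W = flip₄ := by
    rw [hW, transpose_mul]
    calc Vᵀ * Lᴴᵀ * flip₄ * (Lᴴ * V) = Vᵀ * (Lᴴᵀ * flip₄ * Lᴴ) * V := by simp only [mul_assoc]
      _ = flip₄ := by rw [hLf', hVf]
  have hW0 : ∀ x, W x (0, 0) = if x = (0, 0) then 1 else 0 := by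
    have hcol : W *ᵥ Pi.single (0, 0) 1 = Pi.single (0, 0) 1 := by
      have hLe : L *ᵥ Pi.single (0, 0) 1 = tensor a b := by
        rw [← he, hL, kronecker_mulVec_tensor]
        congr 1 <;> (ext i; fin_cases i <;> simp [su2])
      rw [hW, ← mulVec_mulVec, hab, ← hLe, mulVec_mulVec, hLu, one_mulVec]
    intro x
    have := congrFun hcol x
    simpa [Pi.single_apply] using this
  obtain ⟨p, q, r, t, hcase, hWe⟩ := entries_of_fix hWu hWf hW0
  rw [hTV, hVL]
  rcases hcase with ⟨hq, hr, hpt, hp, ht⟩ | ⟨hp, ht, hqr, hq, hr⟩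
  -- Here `W` has diagonal entries `1, p, t, 1` with `p * t = 1`, which is a product of local
  -- phases.
  · refine ⟨su2 a * diagonal ![1, t], su2 b * diagonal ![1, p], 1,
      unitary_mul (su2_unitary ha) (phase_unitary ht),
      unitary_mul (su2_unitary hb) (phase_unitary hp), fun _ => Or.inl rfl, ?_⟩
    rw [mul_kronecker_mul, ← hL, show diagonal (1 : Idx → ℂ) = 1 from diagonal_one, mul_one]
    congr 2
    rw [hWe]
    ext ⟨i, j⟩ ⟨k, l⟩
    fin_cases i <;> fin_cases j <;> fin_cases k <;> fin_cases l <;>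
      simp [hq, hr, mul_comm t, hpt]
  -- Here `W` is a local phase times the swap of the qubits, which only changes the sign of the
  -- antisymmetric magic vector, the column `(1, 0)`.
  · refine ⟨su2 a * diagonal ![1, r], su2 b * diagonal ![1, q], fun i => if i = (1, 0) then -1 else 1,
      unitary_mul (su2_unitary ha) (phase_unitary hr),
      unitary_mul (su2_unitary hb) (phase_unitary hq), fun i => by
        by_cases h : i = (1, 0)
        · exact Or.inr (if_pos h)
        · exact Or.inl (if_neg h), ?_⟩
    rw [mul_kronecker_mul, ← hL]
    simp only [mul_assoc]
    congr 1
    rw [hWe]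
    ext ⟨i, j⟩ ⟨k, l⟩
    rw [← mul_assoc, mul_diagonal]
    simp only [mul_apply, Fintype.sum_prod_type, Fin.sum_univ_two, of_apply, kroneckerMap_apply,
      magic]
    generalize (((Real.sqrt 2)⁻¹ : ℝ) : ℂ) = s
    fin_cases i <;> fin_cases j <;> fin_cases k <;> fin_cases l <;>
      simp [hp, ht] <;>
      first | ring1 | linear_combination (-s) * hqr | linear_combination (s * Complex.I) * hqr |
        linear_combination (-s * Complex.I) * hqr

/-- The Cartan decomposition of a two-qubit unitary. -/
theorem DiagonalForms.exists_cartan {U T : Op} {Δ : Idx → ℂ} (h : DiagonalForms U T Δ)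
    (hU : Uᴴ * U = 1) :
    ∃ (A₁ B₁ A₂ B₂ : Matrix (Fin 2) (Fin 2) ℂ) (d : Idx → ℂ), A₁ᴴ * A₁ = 1 ∧ B₁ᴴ * B₁ = 1 ∧
      A₂ᴴ * A₂ = 1 ∧ B₂ᴴ * B₂ = 1 ∧ (∀ i, d i ^ 2 = Δ i) ∧ (∀ i, star (d i) * d i = 1) ∧
      U = (A₁ ⊗ₖ B₁) * (magic * diagonal d * magicᴴ) * (A₂ ⊗ₖ B₂) := by
  choose d hd using fun i => IsAlgClosed.exists_pow_nat_eq (Δ i) (n := 2) (by norm_num)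
  have hUT : (U * T)ᴴ * (U * T) = 1 := unitary_mul hU h.unitary
  have hUT' : (U * T)ᵀᴴ * (U * T)ᵀ = 1 := by
    have h := congrArg transpose (mul_eq_one_comm.mp hUT)
    rwa [transpose_mul, transpose_one] at h
  have hfu : flip₄ᴴ * flip₄ = 1 := by
    ext ⟨i, j⟩ ⟨k, l⟩
    simp only [mul_apply, conjTranspose_apply, Fintype.sum_prod_type, Fin.sum_univ_two, one_apply,
      flip₄, flip₂, kroneckerMap_apply]
    fin_cases i <;> fin_cases j <;> fin_cases k <;> fin_cases l <;> simp
  have hΔu : (diagonal Δ)ᴴ * diagonal Δ = 1 := by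
    rw [← h.output]
    exact unitary_mul (unitary_mul hUT' hfu) hUT
  have hΔ1 : ∀ i, star (Δ i) * Δ i = 1 := fun i => by
    have := congrFun (congrFun hΔu i) i
    simpa using this
  have hd1 : ∀ i, star (d i) * d i = 1 := by
    intro i
    have h1 := hΔ1 i
    rw [← hd i, star_pow, ← mul_pow] at h1
    have h2 : (0 : ℂ) ≤ star (d i) * d i := star_mul_self_nonneg _
    rcases mul_eq_zero.mp (show (star (d i) * d i - 1) * (star (d i) * d i + 1) = 0 by
      linear_combination h1) with h3 | h3
    · exact sub_eq_zero.mp h3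
    · rw [eq_neg_of_add_eq_zero_left h3] at h2
      have := (Complex.nonneg_iff.mp h2).1
      norm_num at this
  -- Dividing the columns of `U * T` by square roots of `Δ` normalizes the output form. So both `E`
  -- and `T` are local unitaries times the magic basis up to signs, and `U = E * diagonal d * Tᴴ`;
  -- the signs are absorbed into `d`.
  set E := U * T * diagonal (star d) with hE
  have hdd : diagonal (star d) * diagonal d = (1 : Op) := by
    rw [diagonal_mul_diagonal, ← diagonal_one]
    congr 1; ext i; exact hd1 i
  have hdd' : (diagonal (star d))ᴴ * diagonal (star d) = (1 : Op) := by
    rw [diagonal_conjTranspose, star_star, ← mul_eq_one_comm]; exact hdd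
  have hEu : Eᴴ * E = 1 := unitary_mul hUT hdd'
  have hEf : Eᵀ * flip₄ * E = 1 := by
    rw [hE, transpose_mul (U * T), diagonal_transpose]
    calc diagonal (star d) * (U * T)ᵀ * flip₄ * (U * T * diagonal (star d))
        = diagonal (star d) * ((U * T)ᵀ * flip₄ * (U * T)) * diagonal (star d) := by
          simp only [mul_assoc]
      _ = 1 := by
          rw [h.output, diagonal_mul_diagonal, diagonal_mul_diagonal, ← diagonal_one]
          congr 1; ext i
          have := hd1 i
          rw [← hd i]
          simp only [Pi.star_apply]
          linear_combination (star (d i) * d i + 1) * this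
  obtain ⟨A₁, B₁, η, hA₁, hB₁, hη, hEe⟩ := eq_kronecker_mul_magic hEu hEf
  obtain ⟨A₂, B₂, θ, hA₂, hB₂, hθ, hTe⟩ := eq_kronecker_mul_magic h.unitary h.input
  have hsq : ∀ ε : ℂ, ε = 1 ∨ ε = -1 → ε ^ 2 = 1 ∧ star ε = ε := by
    rintro ε (rfl | rfl) <;> simp
  refine ⟨A₁, B₁, A₂ᴴ, B₂ᴴ, fun i => η i * d i * θ i, hA₁, hB₁, ?_, ?_, ?_, ?_, ?_⟩
  · rw [conjTranspose_conjTranspose, ← mul_eq_one_comm]; exact hA₂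
  · rw [conjTranspose_conjTranspose, ← mul_eq_one_comm]; exact hB₂
  · intro i
    rw [← hd i, mul_pow, mul_pow, (hsq _ (hη i)).1, (hsq _ (hθ i)).1]; ring
  · intro i
    rw [star_mul', star_mul', (hsq _ (hη i)).2, (hsq _ (hθ i)).2]
    linear_combination η i ^ 2 * θ i ^ 2 * hd1 i + θ i ^ 2 * (hsq _ (hη i)).1 + (hsq _ (hθ i)).1
  · have hUE : U = E * diagonal d * Tᴴ := by
      rw [hE, mul_assoc (U * T), hdd, mul_one, mul_assoc, mul_eq_one_comm.mp h.unitary, mul_one]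
    have hTH : Tᴴ = diagonal θ * magicᴴ * (A₂ᴴ ⊗ₖ B₂ᴴ) := by
      rw [hTe, conjTranspose_mul, conjTranspose_mul, conjTranspose_kronecker,
        diagonal_conjTranspose, mul_assoc]
      congr 2
      ext i; exact (hsq _ (hθ i)).2
    rw [hUE, hTH, hEe, show diagonal (fun i => η i * d i * θ i) =
      diagonal η * diagonal d * diagonal θ by rw [diagonal_mul_diagonal, diagonal_mul_diagonal]]
    simp only [mul_assoc]

/-! ### Schmidt coefficients under local unitaries -/

/-- The realignment of an operator, as a matrix between `AA'` and `BB'`. -/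
def realign (U : Op) : Op := Matrix.of fun x y => U (x.1, y.1) (x.2, y.2)

theorem choi_eq (U : Op) (x y : Idx) : choi U x y = (1 / 2 : ℂ) * realign U x y := by
  have h := inv_sqrt_two_mul_self
  simp only [choi, bell, realign, of_apply]
  generalize (((Real.sqrt 2)⁻¹ : ℝ) : ℂ) = s at h
  rw [Finset.sum_eq_single x.2 _ (by simp), Finset.sum_eq_single y.2 _ (by simp)]
  · simp only [if_true, ← h]; ring
  · intro l _ hl; simp [hl]
  · intro k _ hk; simp [hk]

/-- Local factors on either side of `N` become multiplication by `A₁ ⊗ₖ A₂ᵀ` on the `AA'` side and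
`B₁ ⊗ₖ B₂ᵀ` on the `BB'` side. When these are unitary, the singular values are unchanged. -/
theorem realign_local_mul (A₁ B₁ A₂ B₂ : Matrix (Fin 2) (Fin 2) ℂ) (N : Op) :
    realign ((A₁ ⊗ₖ B₁) * N * (A₂ ⊗ₖ B₂)) =
      (A₁ ⊗ₖ A₂ᵀ) * realign N * (B₁ ⊗ₖ B₂ᵀ)ᵀ := by
  ext x y
  simp only [realign, of_apply, mul_apply, Fintype.sum_prod_type, Fin.sum_univ_two,
    kroneckerMap_apply, transpose_apply]
  ring

/-- Coefficients of a Bell-diagonal operator in the Pauli basis, up to phases. -/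
def pauliCoeff (d : Idx → ℂ) : Idx → ℂ := fun k =>
  if k = (0, 0) then (d (0, 0) + d (0, 1) + d (1, 0) + d (1, 1)) / 2
  else if k = (0, 1) then -(d (0, 0) - d (1, 1) + d (0, 1) - d (1, 0)) / 2
  else if k = (1, 0) then (d (0, 0) - d (1, 1) - d (0, 1) + d (1, 0)) / 2
  else -(d (0, 0) + d (1, 1) - d (0, 1) - d (1, 0)) / 2

/-- A Bell-diagonal operator is a combination of the `σ ⊗ σ`, and the vectorized Pauli matrices are,
up to scalars, again the magic basis. -/
theorem realign_magic (d : Idx → ℂ) : realign (magic * diagonal d * magicᴴ) =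
    magic * diagonal (pauliCoeff d) * magicᵀ := by
  have h := inv_sqrt_two_mul_self
  ext ⟨i, j⟩ ⟨k, l⟩
  simp only [realign, of_apply]
  rw [mul_apply, mul_apply]
  simp only [mul_diagonal, Fintype.sum_prod_type, Fin.sum_univ_two, conjTranspose_apply,
    transpose_apply, magic, of_apply, star_mul', Complex.star_def, Complex.conj_ofReal, pauliCoeff]
  generalize (((Real.sqrt 2)⁻¹ : ℝ) : ℂ) = s at h
  fin_cases i <;> fin_cases j <;> fin_cases k <;> fin_cases l <;> simp <;> ring_nf <;> simp <;> ring1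

/-- One entry is strictly larger than the others, which are equal and positive. -/
def HasDominant {n : Type*} (f : n → ℝ) : Prop :=
  ∃ k r, 0 < r ∧ r < f k ∧ ∀ j, j ≠ k → f j = r

/-- The property depends only on the multiset of values, which is all that a comparison of spectra
provides. -/
theorem hasDominant_iff_multiset {n : Type*} [Fintype n] [DecidableEq n] (hn : Fintype.card n = 4)
    (f : n → ℝ) : HasDominant f ↔
      ∃ R r, 0 < r ∧ r < R ∧ Finset.univ.val.map f = R ::ₘ Multiset.replicate 3 r := by
  have hsplit : ∀ k : n, Finset.univ.val.map f = f k ::ₘ (Finset.univ.erase k).val.map f := by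
    intro k
    rw [← Multiset.map_cons, ← Finset.insert_val_of_notMem (Finset.notMem_erase k _),
      Finset.insert_erase (Finset.mem_univ k)]
  have hcard : ∀ k : n, Multiset.card ((Finset.univ.erase k).val.map f) = 3 := by
    intro k
    rw [Multiset.card_map, Finset.card_val, Finset.card_erase_of_mem (Finset.mem_univ k),
      Finset.card_univ, hn]
  constructor
  · rintro ⟨k, r, h0, h1, h2⟩
    refine ⟨f k, r, h0, h1, ?_⟩
    rw [hsplit k, Multiset.cons_inj_right, Multiset.eq_replicate]
    refine ⟨hcard k, fun b hb => ?_⟩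
    obtain ⟨j, hj, rfl⟩ := Multiset.mem_map.mp hb
    exact h2 j (Finset.ne_of_mem_erase hj)
  · rintro ⟨R, r, h0, h1, h2⟩
    have hR : R ∈ Finset.univ.val.map f := by rw [h2]; exact Multiset.mem_cons_self _ _
    obtain ⟨k, -, rfl⟩ := Multiset.mem_map.mp hR
    rw [hsplit k, Multiset.cons_inj_right, Multiset.eq_replicate] at h2
    exact ⟨k, r, h0, h1, fun j hj => h2.2 _ (Multiset.mem_map_of_mem f
      (Finset.mem_erase.mpr ⟨hj, Finset.mem_univ j⟩))⟩

theorem map_eq_of_conj_diagonal {n : Type*} [Fintype n] [DecidableEq n] {V W : Matrix n n ℂ}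
    (hV : Vᴴ * V = 1) (hW : Wᴴ * W = 1) {a b : n → ℝ}
    (h : V * diagonal (fun i => (a i : ℂ)) * Vᴴ = W * diagonal (fun i => (b i : ℂ)) * Wᴴ) :
    Finset.univ.val.map a = Finset.univ.val.map b := by
  have hchar : ∀ (X : Matrix n n ℂ) (hX : Xᴴ * X = 1) (c : n → ℝ),
      (X * diagonal (fun i => (c i : ℂ)) * Xᴴ).charpoly.roots =
        Finset.univ.val.map fun i => (c i : ℂ) := by
    intro X hX c
    rw [charpoly_mul_comm, ← mul_assoc, hX, one_mul, charpoly_diagonal]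
    rw [← Polynomial.roots_multiset_prod_X_sub_C (Finset.univ.val.map fun i => (c i : ℂ)),
      Multiset.map_map]
    rfl
  have h2 : Finset.univ.val.map (fun i => (a i : ℂ)) = Finset.univ.val.map fun i => (b i : ℂ) := by
    rw [← hchar V hV, ← hchar W hW, h]
  have h3 := congrArg (Multiset.map Complex.re) h2
  simpa [Multiset.map_map] using h3

/-- The Schmidt decomposition and the Cartan decomposition both give a singular value decomposition
of the Choi matrix `C`, up to phases; the two resulting diagonalizations of `C * Cᴴ` have the same
eigenvalues. -/
theorem IsSchmidtCoeffs.hasDominant_iff {U : Op} {s : Fin 4 → ℝ} (hs : IsSchmidtCoeffs U s)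
    {A₁ B₁ A₂ B₂ : Matrix (Fin 2) (Fin 2) ℂ} {d : Idx → ℂ} (hA₁ : A₁ᴴ * A₁ = 1)
    (hB₁ : B₁ᴴ * B₁ = 1) (hA₂ : A₂ᴴ * A₂ = 1) (hB₂ : B₂ᴴ * B₂ = 1)
    (hd : U = (A₁ ⊗ₖ B₁) * (magic * diagonal d * magicᴴ) * (A₂ ⊗ₖ B₂)) :
    HasDominant (fun k => s k ^ 2) ↔
      HasDominant fun k => Complex.normSq (pauliCoeff d k) / 4 := by
  obtain ⟨-, -, e, f, he, hf, hef⟩ := hs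
  let σ : Idx ≃ Fin 4 := Fintype.equivFinOfCardEq (by simp [Idx])
  have transpose_unitary : ∀ {n : Type} [Fintype n] [DecidableEq n] {A : Matrix n n ℂ},
      Aᴴ * A = 1 → Aᵀᴴ * Aᵀ = 1 := by
    intro n _ _ A hA
    have h := congrArg transpose (mul_eq_one_comm.mp hA)
    rwa [transpose_mul, transpose_one] at h
  set C : Op := Matrix.of fun x y => choi U x y with hC
  set P : Op := (A₁ ⊗ₖ A₂ᵀ) * magic with hP
  set Q : Op := ((B₁ ⊗ₖ B₂ᵀ) * magic)ᵀ with hQ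
  have hPu : Pᴴ * P = 1 :=
    unitary_mul (kronecker_unitary hA₁ (transpose_unitary hA₂)) magic_unitary
  have hQu : Qᴴ * Q = 1 := transpose_unitary
    (unitary_mul (kronecker_unitary hB₁ (transpose_unitary hB₂)) magic_unitary)
  have hC1 : C = P * diagonal (fun k => (1 / 2 : ℂ) * pauliCoeff d k) * Q := by
    have h1 : C = (1 / 2 : ℂ) • realign U := by
      ext x y; simp [hC, choi_eq]
    have h2 : diagonal (fun k => (1 / 2 : ℂ) * pauliCoeff d k) =
        (1 / 2 : ℂ) • diagonal (pauliCoeff d) := by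
      rw [← diagonal_smul]; rfl
    rw [h1, hd, realign_local_mul, realign_magic, h2, hP, hQ, transpose_mul, mul_smul_comm,
      smul_mul_assoc]
    simp only [mul_assoc]
  set E : Op := Matrix.of fun x k => e (σ k) x with hE
  set F : Op := Matrix.of fun x k => f (σ k) x with hF
  have hcol : ∀ g : Fin 4 → EuclideanSpace ℂ (Fin 2 × Fin 2), Orthonormal ℂ g →
      (Matrix.of fun x k => g (σ k) x : Op)ᴴ * (Matrix.of fun x k => g (σ k) x : Op) = 1 := by
    intro g hg
    ext k l
    have := orthonormal_iff_ite.mp hg (σ k) (σ l)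
    rw [EuclideanSpace.inner_eq_star_dotProduct, dotProduct_comm] at this
    simp only [EmbeddingLike.apply_eq_iff_eq] at this
    rw [one_apply, ← this]
    rfl
  have hEu : Eᴴ * E = 1 := hcol e he
  have hFu : Fᴴ * F = 1 := hcol f hf
  have hC2 : C = E * diagonal (fun k => (s (σ k) : ℂ)) * Fᵀ := by
    ext x y
    rw [mul_apply]
    simp only [mul_diagonal, transpose_apply, hC, hE, hF, of_apply]
    rw [hef, ← σ.sum_comp]
    exact Finset.sum_congr rfl fun k _ => by ring
  have hgen : ∀ (X D Y : Op), Yᴴ * Y = 1 → (X * D * Y) * (X * D * Y)ᴴ = X * (D * Dᴴ) * Xᴴ := by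
    intro X D Y hY
    rw [conjTranspose_mul, conjTranspose_mul]
    calc X * D * Y * (Yᴴ * (Dᴴ * Xᴴ)) = X * D * (Y * Yᴴ) * (Dᴴ * Xᴴ) := by simp only [mul_assoc]
      _ = _ := by rw [mul_eq_one_comm.mp hY, mul_one]; simp only [mul_assoc]
  have h1 : C * Cᴴ = P * diagonal (fun k => ((Complex.normSq (pauliCoeff d k) / 4 : ℝ) : ℂ)) * Pᴴ := by
    rw [hC1, hgen _ _ _ hQu, diagonal_conjTranspose, diagonal_mul_diagonal]
    congr 3
    ext k
    push_cast
    rw [Complex.normSq_eq_conj_mul_self]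
    simp
    ring
  have h2 : C * Cᴴ = E * diagonal (fun k => ((s (σ k) ^ 2 : ℝ) : ℂ)) * Eᴴ := by
    rw [hC2, hgen _ _ _ (transpose_unitary hFu), diagonal_conjTranspose, diagonal_mul_diagonal]
    congr 3
    ext k
    simp [sq]
  have h3 := map_eq_of_conj_diagonal hPu hEu (h1.symm.trans h2)
  have h4 : Finset.univ.val.map (fun k : Idx => s (σ k) ^ 2) =
      Finset.univ.val.map fun k : Fin 4 => s k ^ 2 := by
    rw [← Multiset.map_univ_val_equiv σ, Multiset.map_map]
    rfl
  rw [hasDominant_iff_multiset (by simp), hasDominant_iff_multiset (by simp [Idx]), h3, h4]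

theorem hasDominant_sq_iff {s : Fin 4 → ℝ} (ha : Antitone s) (h0 : ∀ k, 0 ≤ s k) :
    HasDominant (fun k => s k ^ 2) ↔ s 1 < s 0 ∧ s 1 = s 2 ∧ s 2 = s 3 ∧ 0 < s 3 := by
  constructor
  · rintro ⟨k, r, hr, hk, hj⟩
    have hk0 : k = 0 := by
      by_contra hne
      have h1 := hj 0 (Ne.symm hne)
      have h2 : s k ≤ s 0 := ha (Fin.zero_le k)
      have h3 := pow_le_pow_left₀ (h0 k) h2 2
      simp only at h1 hk
      linarith
    subst hk0
    have h1 := hj 1 (by decide)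
    have h2 := hj 2 (by decide)
    have h3 := hj 3 (by decide)
    simp only at h1 h2 h3 hk
    refine ⟨lt_of_pow_lt_pow_left₀ 2 (h0 0) (by linarith),
      (pow_left_inj₀ (h0 1) (h0 2) two_ne_zero).mp (h1.trans h2.symm),
      (pow_left_inj₀ (h0 2) (h0 3) two_ne_zero).mp (h2.trans h3.symm), ?_⟩
    refine lt_of_le_of_ne (h0 3) fun h => ?_
    rw [← h] at h3
    norm_num at h3
    linarith
  · rintro ⟨h1, h2, h3, h4⟩
    refine ⟨0, s 3 ^ 2, by positivity, ?_, ?_⟩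
    · exact pow_lt_pow_left₀ (by rw [← h3, ← h2]; exact h1) h4.le two_ne_zero
    · intro j hj
      fin_cases j
      · exact absurd rfl hj
      · simp [h2, h3]
      · simp [h3]
      · rfl

/-! ### Bell-diagonal unitaries -/

/-- Up to an even number of sign changes, all three numbers equal some `t` with `0 < t < 2`. -/
def SignedTriple (a b c : ℝ) : Prop :=
  ∃ t, 0 < t ∧ t < 2 ∧ ((a = t ∧ b = t ∧ c = t) ∨ (a = t ∧ b = -t ∧ c = -t) ∨
    (a = -t ∧ b = t ∧ c = -t) ∨ (a = -t ∧ b = -t ∧ c = t))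

theorem SignedTriple.swap {a b c : ℝ} (h : SignedTriple a b c) : SignedTriple b a c := by
  obtain ⟨t, h0, h2, h | h | h | h⟩ := h <;> exact ⟨t, h0, h2, by tauto⟩

theorem SignedTriple.rotate {a b c : ℝ} (h : SignedTriple a b c) : SignedTriple b c a := by
  obtain ⟨t, h0, h2, h | h | h | h⟩ := h <;> exact ⟨t, h0, h2, by tauto⟩

/-- The real inner product of complex numbers. -/
def reInner (u v : ℂ) : ℝ := u.re * v.re + u.im * v.im

theorem reInner_comm (u v : ℂ) : reInner u v = reInner v u := by unfold reInner; ring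

theorem star_mul_self_eq_one_iff {u : ℂ} : star u * u = 1 ↔ u.re ^ 2 + u.im ^ 2 = 1 := by
  rw [Complex.star_def, ← Complex.normSq_eq_conj_mul_self, Complex.normSq_apply]
  norm_cast
  simp [sq]

/-- The four values are `(2 ± a ± b ± c) / 8` with an even number of minus signs. Three equal to `r`
and a fourth larger one means `|a| = |b| = |c| = t` with a sign pattern naming the dominant index
and `t = 2 - 8 * r`; then `r > 0` is `t < 2` and dominance is `t > 0`. -/
theorem hasDominant_pauliCoeff_iff {d : Idx → ℂ} (hd : ∀ i, star (d i) * d i = 1) :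
    HasDominant (fun k => Complex.normSq (pauliCoeff d k) / 4) ↔
      SignedTriple (reInner (d (0, 0)) (d (0, 1)) + reInner (d (1, 0)) (d (1, 1)))
        (reInner (d (0, 0)) (d (1, 0)) + reInner (d (0, 1)) (d (1, 1)))
        (reInner (d (0, 0)) (d (1, 1)) + reInner (d (0, 1)) (d (1, 0))) := by
  set a := reInner (d (0, 0)) (d (0, 1)) + reInner (d (1, 0)) (d (1, 1)) with ha
  set b := reInner (d (0, 0)) (d (1, 0)) + reInner (d (0, 1)) (d (1, 1)) with hb
  set c := reInner (d (0, 0)) (d (1, 1)) + reInner (d (0, 1)) (d (1, 0)) with hc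
  simp only [star_mul_self_eq_one_iff] at hd
  have e0 : Complex.normSq (pauliCoeff d (0, 0)) / 4 = (2 + a + b + c) / 8 := by
    simp [pauliCoeff, Complex.normSq_apply, ha, hb, hc, reInner]
    linear_combination (hd (0, 0) + hd (0, 1) + hd (1, 0) + hd (1, 1)) / 16
  have e1 : Complex.normSq (pauliCoeff d (0, 1)) / 4 = (2 + a - b - c) / 8 := by
    simp [pauliCoeff, Complex.normSq_apply, ha, hb, hc, reInner]
    linear_combination (hd (0, 0) + hd (0, 1) + hd (1, 0) + hd (1, 1)) / 16
  have e2 : Complex.normSq (pauliCoeff d (1, 0)) / 4 = (2 - a + b - c) / 8 := by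
    simp [pauliCoeff, Complex.normSq_apply, ha, hb, hc, reInner]
    linear_combination (hd (0, 0) + hd (0, 1) + hd (1, 0) + hd (1, 1)) / 16
  have e3 : Complex.normSq (pauliCoeff d (1, 1)) / 4 = (2 - a - b + c) / 8 := by
    simp [pauliCoeff, Complex.normSq_apply, ha, hb, hc, reInner]
    linear_combination (hd (0, 0) + hd (0, 1) + hd (1, 0) + hd (1, 1)) / 16
  constructor
  · rintro ⟨⟨i, j⟩, r, hr, hk, hj⟩
    have k0 := hj (0, 0)
    have k1 := hj (0, 1)
    have k2 := hj (1, 0)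
    have k3 := hj (1, 1)
    simp only [e0, e1, e2, e3] at k0 k1 k2 k3
    refine ⟨2 - 8 * r, ?_⟩
    fin_cases i <;> fin_cases j <;> simp [e0, e1, e2, e3] at hk k0 k1 k2 k3
    · exact ⟨by linarith, by linarith, Or.inl ⟨by linarith, by linarith, by linarith⟩⟩
    · exact ⟨by linarith, by linarith, Or.inr (Or.inl ⟨by linarith, by linarith, by linarith⟩)⟩
    · exact ⟨by linarith, by linarith,
        Or.inr (Or.inr (Or.inl ⟨by linarith, by linarith, by linarith⟩))⟩
    · exact ⟨by linarith, by linarith,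
        Or.inr (Or.inr (Or.inr ⟨by linarith, by linarith, by linarith⟩))⟩
  · rintro ⟨t, h0, h2, ⟨h3, h4, h5⟩ | ⟨h3, h4, h5⟩ | ⟨h3, h4, h5⟩ | ⟨h3, h4, h5⟩⟩
    · refine ⟨(0, 0), (2 - t) / 8, by linarith, by simp only [e0]; linarith, ?_⟩
      rintro ⟨i, j⟩ hij
      fin_cases i <;> fin_cases j <;> simp [e1, e2, e3] at hij ⊢ <;> linarith
    · refine ⟨(0, 1), (2 - t) / 8, by linarith, by simp only [e1]; linarith, ?_⟩
      rintro ⟨i, j⟩ hij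
      fin_cases i <;> fin_cases j <;> simp [e0, e2, e3] at hij ⊢ <;> linarith
    · refine ⟨(1, 0), (2 - t) / 8, by linarith, by simp only [e2]; linarith, ?_⟩
      rintro ⟨i, j⟩ hij
      fin_cases i <;> fin_cases j <;> simp [e0, e1, e3] at hij ⊢ <;> linarith
    · refine ⟨(1, 1), (2 - t) / 8, by linarith, by simp only [e3]; linarith, ?_⟩
      rintro ⟨i, j⟩ hij
      fin_cases i <;> fin_cases j <;> simp [e0, e1, e2] at hij ⊢ <;> linarith

/-- Strict Cauchy–Schwarz from Lagrange's identity: equality would make `v = ± u`, hence equal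
squares. -/
theorem reInner_lt_one {u v : ℂ} (hu : star u * u = 1) (hv : star v * v = 1)
    (h : u ^ 2 ≠ v ^ 2) : reInner u v ^ 2 < 1 := by
  rw [star_mul_self_eq_one_iff] at hu hv
  have key : reInner u v ^ 2 + (u.re * v.im - u.im * v.re) ^ 2 = 1 := by
    unfold reInner
    linear_combination (v.re ^ 2 + v.im ^ 2) * hu + hv
  have hne : u.re * v.im - u.im * v.re ≠ 0 := by
    intro h0
    apply h
    apply Complex.ext
    · simp [sq]
      linear_combination (u.re ^ 2 - u.im ^ 2) * (-hv) + (v.re ^ 2 - v.im ^ 2) * hu +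
        2 * (u.re * v.im + u.im * v.re) * h0
    · simp [sq]
      linear_combination (-2 * u.re * u.im) * hv + (2 * v.re * v.im) * hu
        - 2 * (u.re * v.re - u.im * v.im) * h0
  have := sq_pos_of_ne_zero hne
  linarith

/-- Here `d₁` and `d₂` are `± d₀`, so each entry is `± (1 ± x)` with `x = reInner d₀ d₃` and `|x| <
1`; the four sign choices are the four patterns. -/
theorem signedTriple_of_sq_eq {d₀ d₁ d₂ d₃ : ℂ} (h0 : star d₀ * d₀ = 1) (h3 : star d₃ * d₃ = 1)
    (h01 : d₁ ^ 2 = d₀ ^ 2) (h02 : d₂ ^ 2 = d₀ ^ 2) (h03 : d₃ ^ 2 ≠ d₀ ^ 2) :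
    SignedTriple (reInner d₀ d₁ + reInner d₂ d₃) (reInner d₀ d₂ + reInner d₁ d₃)
      (reInner d₀ d₃ + reInner d₁ d₂) := by
  have hx := reInner_lt_one h0 h3 h03.symm
  have hself : reInner d₀ d₀ = 1 := by
    rw [star_mul_self_eq_one_iff] at h0
    unfold reInner; linarith
  have hneg : ∀ u v, reInner u (-v) = -reInner u v := fun u v => by simp [reInner]; ring
  have hneg' : ∀ u v, reInner (-u) v = -reInner u v := fun u v => by simp [reInner]; ring
  have hlt := abs_lt.mp ((sq_lt_one_iff_abs_lt_one _).mp hx)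
  set x := reInner d₀ d₃
  rcases sq_eq_sq_iff_eq_or_eq_neg.mp h01 with rfl | rfl <;>
    rcases sq_eq_sq_iff_eq_or_eq_neg.mp h02 with rfl | rfl
  · exact ⟨1 + x, by linarith, by linarith, Or.inl ⟨by rw [hself], by rw [hself],
      by rw [hself, add_comm]⟩⟩
  · exact ⟨1 - x, by linarith, by linarith, Or.inr (Or.inl
      ⟨by rw [hself, hneg']; ring, by rw [hneg, hself]; ring, by rw [hneg, hself]; ring⟩)⟩
  · exact ⟨1 - x, by linarith, by linarith, Or.inr (Or.inr (Or.inl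
      ⟨by rw [hneg, hself]; ring, by rw [hneg', hself]; ring, by rw [hneg', hself]; ring⟩))⟩
  · exact ⟨1 + x, by linarith, by linarith, Or.inr (Or.inr (Or.inr
      ⟨by rw [hneg, hneg', hself]; ring, by rw [hneg, hneg', hself]; ring,
        by rw [hneg, hneg', hself]; ring⟩))⟩

/-- On the unit circle conjugation is inversion, so real inner products become rational functions,
and this sum factors. -/
theorem two_mul_reInner_add {p q u v : ℂ} (hp : star p * p = 1) (hq : star q * q = 1)
    (hu : star u * u = 1) (hv : star v * v = 1) :
    2 * ((reInner p q + reInner u v : ℝ) : ℂ) * (p * q * u * v) =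
      (p * u + q * v) * (p * v + q * u) := by
  have hre : ∀ x y : ℂ, 2 * (reInner x y : ℂ) = star x * y + star y * x := by
    intro x y
    apply Complex.ext <;> simp [reInner] <;> ring
  rw [Complex.ofReal_add, mul_add, hre, hre]
  linear_combination (q ^ 2 * u * v) * hp + (p ^ 2 * u * v) * hq + (p * q * v ^ 2) * hu
    + (p * q * u ^ 2) * hv

/-- Let `X = pu + qv`, `Y = pv + qu`, `Z = pq + uv`. Up to a common factor, `a`, `b`, `c` are `XY`,
`YZ`, `XZ`, so equal nonzero squares give `X² = Y² = Z²`. The differences of these factor, e.g. `X²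
- Z² = (p² - v²)(u² - q²)`: in each of the three pairings of the four squares, some pair is equal.
Such a choice of edges is a triangle or a star, so at least three squares agree. -/
theorem isSpecial_of_signedTriple {d : Idx → ℂ} (hd : ∀ i, star (d i) * d i = 1)
    (h : SignedTriple (reInner (d (0, 0)) (d (0, 1)) + reInner (d (1, 0)) (d (1, 1)))
        (reInner (d (0, 0)) (d (1, 0)) + reInner (d (0, 1)) (d (1, 1)))
        (reInner (d (0, 0)) (d (1, 1)) + reInner (d (0, 1)) (d (1, 0)))) :
    IsSpecial fun i => d i ^ 2 := by
  have hd0 : ∀ i, d i ≠ 0 := fun i hi => by have := hd i; simp [hi] at this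
  obtain ⟨t, ht0, ht2, hcase⟩ := h
  have ea := two_mul_reInner_add (hd (0, 0)) (hd (0, 1)) (hd (1, 0)) (hd (1, 1))
  have eb := two_mul_reInner_add (hd (0, 0)) (hd (1, 0)) (hd (0, 1)) (hd (1, 1))
  have ec := two_mul_reInner_add (hd (0, 0)) (hd (1, 1)) (hd (0, 1)) (hd (1, 0))
  set a := reInner (d (0, 0)) (d (0, 1)) + reInner (d (1, 0)) (d (1, 1)) with ha
  set b := reInner (d (0, 0)) (d (1, 0)) + reInner (d (0, 1)) (d (1, 1))
  set c := reInner (d (0, 0)) (d (1, 1)) + reInner (d (0, 1)) (d (1, 0))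
  have hsq : a ^ 2 = t ^ 2 ∧ b ^ 2 = t ^ 2 ∧ c ^ 2 = t ^ 2 := by
    rcases hcase with ⟨h1, h2, h3⟩ | ⟨h1, h2, h3⟩ | ⟨h1, h2, h3⟩ | ⟨h1, h2, h3⟩ <;>
      rw [h1, h2, h3] <;> simp
  obtain ⟨hsa, hsb, hsc⟩ := hsq
  have hsa' : (a : ℂ) ^ 2 = (t : ℂ) ^ 2 := by exact_mod_cast hsa
  have hsb' : (b : ℂ) ^ 2 = (t : ℂ) ^ 2 := by exact_mod_cast hsb
  have hsc' : (c : ℂ) ^ 2 = (t : ℂ) ^ 2 := by exact_mod_cast hsc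
  have ht : (t : ℂ) ≠ 0 := by exact_mod_cast ht0.ne'
  have n0 := hd0 (0, 0)
  have n1 := hd0 (0, 1)
  have n2 := hd0 (1, 0)
  have n3 := hd0 (1, 1)
  -- If all four squares agreed, `a` would be `0` or `± 2`, which `0 < t < 2` excludes.
  have habs : ¬ (a ^ 2 = 4 ∨ a = 0) := by
    rintro (h | h)
    · nlinarith
    · rw [h] at hsa; nlinarith
  have hpm : ∀ i, d i ^ 2 = d (0, 0) ^ 2 → d i = d (0, 0) ∨ d i = -d (0, 0) := fun i h =>
    sq_eq_sq_iff_eq_or_eq_neg.mp h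
  have hnot : ¬ (d (0, 1) ^ 2 = d (0, 0) ^ 2 ∧ d (1, 0) ^ 2 = d (0, 0) ^ 2 ∧
      d (1, 1) ^ 2 = d (0, 0) ^ 2) := by
    rintro ⟨h1, h2, h3⟩
    apply habs
    have hself : (d (0, 0)).re * (d (0, 0)).re + (d (0, 0)).im * (d (0, 0)).im = 1 := by
      have := star_mul_self_eq_one_iff.mp (hd (0, 0))
      linarith
    rw [ha]
    unfold reInner
    rcases hpm _ h1 with h1 | h1 <;> rcases hpm _ h2 with h2 | h2 <;>
      rcases hpm _ h3 with h3 | h3 <;> rw [h1, h2, h3] <;>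
      simp only [Complex.neg_re, Complex.neg_im, mul_neg, neg_mul, neg_neg, ← neg_add, hself] <;>
      norm_num
  set p := d (0, 0)
  set q := d (0, 1)
  set u := d (1, 0)
  set v := d (1, 1)
  have hP : p * q * u * v ≠ 0 := by simp [n0, n1, n2, n3]
  have key : ∀ {x y z w : ℂ} {α β : ℝ}, (α : ℂ) ^ 2 = (t : ℂ) ^ 2 → (β : ℂ) ^ 2 = (t : ℂ) ^ 2 →
      2 * (α : ℂ) * (p * q * u * v) = x * z → 2 * (β : ℂ) * (p * q * u * v) = y * z →
      w = x ^ 2 - y ^ 2 → w = 0 := by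
    intro x y z w α β hα hβ h1 h2 hw
    have hz : z ≠ 0 := by
      rintro rfl
      rw [mul_zero] at h1
      have hα0 : (α : ℂ) ≠ 0 := by
        intro h0
        rw [h0] at hα
        exact ht (pow_eq_zero_iff two_ne_zero |>.mp (by rw [← hα]; simp))
      exact mul_ne_zero (mul_ne_zero two_ne_zero hα0) hP h1
    have h3 : w * z ^ 2 = 0 := by
      rw [hw]
      linear_combination -(x * z + 2 * (α : ℂ) * (p * q * u * v)) * h1
        + (y * z + 2 * (β : ℂ) * (p * q * u * v)) * h2
        + 4 * (p * q * u * v) ^ 2 * (hα - hβ)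
    exact (mul_eq_zero.mp h3).resolve_right (pow_ne_zero 2 hz)
  have k1 := key (x := p * u + q * v) (y := p * q + u * v) (z := p * v + q * u)
    (w := (p ^ 2 - v ^ 2) * (u ^ 2 - q ^ 2)) hsa' hsb' ea (by linear_combination eb) (by ring)
  have k2 := key (x := p * v + q * u) (y := p * u + q * v) (z := p * q + u * v)
    (w := (p ^ 2 - q ^ 2) * (v ^ 2 - u ^ 2)) hsb' hsc' (by linear_combination eb)
    (by linear_combination ec) (by ring)
  have k3 := key (x := p * v + q * u) (y := p * q + u * v) (z := p * u + q * v)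
    (w := (p ^ 2 - u ^ 2) * (v ^ 2 - q ^ 2)) hsa' hsc' (by linear_combination ea)
    (by linear_combination ec) (by ring)
  simp only [mul_eq_zero, sub_eq_zero] at k1 k2 k3
  have s0 : q ^ 2 = u ^ 2 → q ^ 2 = v ^ 2 → p ^ 2 ≠ q ^ 2 → IsSpecial fun i => d i ^ 2 := by
    refine fun h1 h2 h3 => ⟨(0, 0), q ^ 2, h3, ?_⟩
    rintro ⟨i, j⟩ hij
    fin_cases i <;> fin_cases j
    exacts [absurd rfl hij, rfl, h1.symm, h2.symm]
  have s1 : u ^ 2 = p ^ 2 → v ^ 2 = p ^ 2 → q ^ 2 ≠ p ^ 2 → IsSpecial fun i => d i ^ 2 := by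
    refine fun h1 h2 h3 => ⟨(0, 1), p ^ 2, h3, ?_⟩
    rintro ⟨i, j⟩ hij
    fin_cases i <;> fin_cases j
    exacts [rfl, absurd rfl hij, h1, h2]
  have s2 : q ^ 2 = p ^ 2 → v ^ 2 = p ^ 2 → u ^ 2 ≠ p ^ 2 → IsSpecial fun i => d i ^ 2 := by
    refine fun h1 h2 h3 => ⟨(1, 0), p ^ 2, h3, ?_⟩
    rintro ⟨i, j⟩ hij
    fin_cases i <;> fin_cases j
    exacts [rfl, h1, absurd rfl hij, h2]
  have s3 : q ^ 2 = p ^ 2 → u ^ 2 = p ^ 2 → v ^ 2 ≠ p ^ 2 → IsSpecial fun i => d i ^ 2 := by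
    refine fun h1 h2 h3 => ⟨(1, 1), p ^ 2, h3, ?_⟩
    rintro ⟨i, j⟩ hij
    fin_cases i <;> fin_cases j
    exacts [rfl, h1, h2, absurd rfl hij]
  clear key ea eb ec hpm
  generalize p ^ 2 = p' at *
  generalize q ^ 2 = q' at *
  generalize u ^ 2 = u' at *
  generalize v ^ 2 = v' at *
  by_contra hG
  have t0 := fun h1 h2 h3 => hG (s0 h1 h2 h3)
  have t1 := fun h1 h2 h3 => hG (s1 h1 h2 h3)
  have t2 := fun h1 h2 h3 => hG (s2 h1 h2 h3)
  have t3 := fun h1 h2 h3 => hG (s3 h1 h2 h3)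
  clear s0 s1 s2 s3 hG
  grind

/-- Permuting the four indices permutes the three pairings, and `SignedTriple` is symmetric, so the
exceptional index may be moved to the last place. -/
theorem signedTriple_of_isSpecial {d : Idx → ℂ} (hd : ∀ i, star (d i) * d i = 1)
    (h : IsSpecial fun i => d i ^ 2) :
    SignedTriple (reInner (d (0, 0)) (d (0, 1)) + reInner (d (1, 0)) (d (1, 1)))
      (reInner (d (0, 0)) (d (1, 0)) + reInner (d (0, 1)) (d (1, 1)))
      (reInner (d (0, 0)) (d (1, 1)) + reInner (d (0, 1)) (d (1, 0))) := by
  have main : ∀ i j k l, d j ^ 2 = d i ^ 2 → d k ^ 2 = d i ^ 2 → d l ^ 2 ≠ d i ^ 2 →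
      SignedTriple (reInner (d i) (d j) + reInner (d k) (d l))
        (reInner (d i) (d k) + reInner (d j) (d l)) (reInner (d i) (d l) + reInner (d j) (d k)) :=
    fun i j k l => signedTriple_of_sq_eq (hd i) (hd l)
  obtain ⟨⟨i, j⟩, c, hk, hj⟩ := h
  have k0 := hj (0, 0)
  have k1 := hj (0, 1)
  have k2 := hj (1, 0)
  have k3 := hj (1, 1)
  fin_cases i <;> fin_cases j <;> simp at hk k0 k1 k2 k3
  · have := main (1, 1) (0, 1) (1, 0) (0, 0) (by rw [k1, k3]) (by rw [k2, k3]) (by rwa [k3])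
    rw [reInner_comm (d (1, 1)), reInner_comm (d (1, 0)) (d (0, 0)), reInner_comm (d (1, 1)),
      reInner_comm (d (0, 1)) (d (0, 0)), reInner_comm (d (1, 1)) (d (0, 0)),
      add_comm (reInner (d (0, 1)) (d (1, 1))), add_comm (reInner (d (1, 0)) (d (1, 1)))] at this
    exact this.swap
  · have := main (0, 0) (1, 1) (1, 0) (0, 1) (by rw [k3, k0]) (by rw [k2, k0]) (by rwa [k0])
    rw [reInner_comm (d (1, 0)) (d (0, 1)), reInner_comm (d (1, 1)) (d (0, 1)),
      reInner_comm (d (1, 1)) (d (1, 0))] at this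
    exact this.rotate.swap
  · have := main (0, 0) (0, 1) (1, 1) (1, 0) (by rw [k1, k0]) (by rw [k3, k0]) (by rwa [k0])
    rw [reInner_comm (d (1, 1)) (d (1, 0))] at this
    exact this.rotate.rotate.swap
  · exact main (0, 0) (0, 1) (1, 0) (1, 1) (by rw [k1, k0]) (by rw [k2, k0]) (by rwa [k0])

theorem IsSchmidtCoeffs.isSpecial_iff {U T : Op} {Δ : Idx → ℂ} (h : DiagonalForms U T Δ)
    (hU : Uᴴ * U = 1) {s : Fin 4 → ℝ} (hs : IsSchmidtCoeffs U s) :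
    IsSpecial Δ ↔ s 1 < s 0 ∧ s 1 = s 2 ∧ s 2 = s 3 ∧ 0 < s 3 := by
  obtain ⟨A₁, B₁, A₂, B₂, d, hA₁, hB₁, hA₂, hB₂, hdΔ, hd, hUd⟩ := h.exists_cartan hU
  rw [← hasDominant_sq_iff hs.1 hs.2.1, hs.hasDominant_iff hA₁ hB₁ hA₂ hB₂ hUd,
    hasDominant_pauliCoeff_iff hd, ← funext hdΔ]
  exact ⟨signedTriple_of_isSpecial hd, isSpecial_of_signedTriple hd⟩

theorem mu_eq {U : Op} {n : ℕ} (hex : ∃ P : GateProtocol U, P.Ordinary ∧ P.Reliable ∧ P.settings = n)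
    (hle : ∀ P : GateProtocol U, P.Ordinary → P.Reliable → n ≤ P.settings) : mu U = n :=
  le_antisymm (Nat.sInf_le hex) (le_csInf ⟨n, hex⟩ (by
    rintro _ ⟨P, hO, hR, rfl⟩
    exact hle P hO hR))

end TwoQubit

end

theorem theorem4 (U : Matrix (Fin 2 × Fin 2) (Fin 2 × Fin 2) ℂ)
    (hU : U ∈ Matrix.unitaryGroup (Fin 2 × Fin 2) ℂ)
    (s : Fin 4 → ℝ) (hs : TwoQubit.IsSchmidtCoeffs U s) :
    ((s 1 < s 0 ∧ s 1 = s 2 ∧ s 2 = s 3 ∧ 0 < s 3) → TwoQubit.mu U = 5) ∧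
    (¬ (s 1 < s 0 ∧ s 1 = s 2 ∧ s 2 = s 3 ∧ 0 < s 3) → TwoQubit.mu U = 4) ∧
    ((∃ P : TwoQubit.GateProtocol U, P.Reliable ∧ P.EntanglementFree) ↔
      ¬ (s 1 < s 0 ∧ s 1 = s 2 ∧ s 2 = s 3 ∧ 0 < s 3)) ∧
    ((∃ P : TwoQubit.GateProtocol U, P.Ordinary ∧ P.Reliable ∧ P.EntanglementFree) ↔
      ¬ (s 1 < s 0 ∧ s 1 = s 2 ∧ s 2 = s 3 ∧ 0 < s 3)) := by
  obtain ⟨T, Δ, h1, h2, h3⟩ := TwoQubit.exists_diagonal_forms (Matrix.mem_unitaryGroup_iff'.mp hU)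
  have hU' : Uᴴ * U = 1 := Matrix.mem_unitaryGroup_iff'.mp hU
  have h : TwoQubit.DiagonalForms U T Δ := ⟨h1, h2, h3⟩
  rw [← hs.isSpecial_iff h hU']
  refine ⟨fun hΔ => ?_, fun hΔ => ?_, ⟨?_, fun hΔ => ?_⟩, ⟨?_, fun hΔ => ?_⟩⟩
  · refine TwoQubit.mu_eq (h.exists_protocol_five hU' hΔ) fun P hO hR => ?_
    obtain ⟨h4, hEF⟩ := P.four_le_settings hU' hO hR
    rcases h4.eq_or_lt with h5 | h5
    -- Four settings would make the protocol entanglement free, which the special case forbids;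
    -- hence at least five.
    · exact absurd (hEF h5.symm) (h.not_entanglementFree hU' hΔ hR)
    · exact h5
  · obtain ⟨P, hO, hR, hset, -⟩ := h.exists_protocol_of_not_isSpecial hU' hΔ
    exact TwoQubit.mu_eq ⟨P, hO, hR, hset⟩ fun P hO hR => (P.four_le_settings hU' hO hR).1
  · rintro ⟨P, hR, hEF⟩ hΔ
    exact h.not_entanglementFree hU' hΔ hR hEF
  · obtain ⟨P, -, hR, -, hEF⟩ := h.exists_protocol_of_not_isSpecial hU' hΔ
    exact ⟨P, hR, hEF⟩
  · rintro ⟨P, -, hR, hEF⟩ hΔ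
    exact h.not_entanglementFree hU' hΔ hR hEF
  · obtain ⟨P, hO, hR, -, hEF⟩ := h.exists_protocol_of_not_isSpecial hU' hΔ
    exact ⟨P, hO, hR, hEF⟩
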